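/- Let $\mathcal H=\mathbb C^{d}$ be a finite-dimensional Hilbert space with standard matrix trace $\operatorname{tr}$, let $\mathcal N\subseteq\mathcal M\subseteq \mathcal B(\mathcal H)$ be von Neumann subalgebras (unital $*$-subalgebras), and let $E_{\mathcal N}:\mathcal M\to\mathcal N$ be a conditional expectation, i.e. a completely positive unital linear map with $E_{\mathcal N}(x)=x$ for $x\in\mathcal N$ and $E_{\mathcal N}(aXb)=aE_{\mathcal N}(X)b$ for $a,b\in\mathcal N$, $X\in\mathcal M$. Let $E_{\mathcal N*}:\mathcal M\to\mathcal M$ be its adjoint, $\operatorname{tr}(E_{\mathcal N*}(X)Y)=\operatorname{tr}(XE_{\mathcal N}(Y))$, put $\sigma_{\operatorname{tr}}:=E_{\mathcal N*}(\mathbf 1/\operatorname{tr}(\mathbf 1))$, and assume that $\sigma_{\operatorname{tr}}$ has full rank (equivalently, that $E_{\mathcal N}$ is faithful). For a full-rank state $\sigma$ let $\|x\|_{L_p(\sigma)}=\big(\operatorname{tr}\,|\sigma^{1/2p}x\sigma^{1/2p}|^p\big)^{1/p}$ for $1\le p<\infty$ and let $\|x\|_{L_\infty(\sigma)}$ be the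 operator norm. The amalgamated space $L_\infty^p(\mathcal N\subset\mathcal M)$, with respect to $\sigma$, is $\mathcal M$ with the norm $$\|y\|_{L_\infty^p(\mathcal N\subset\mathcal M)}=\sup_{0\ne a,b\in\mathcal N}\frac{\|ayb\|_{L_p(\sigma)}}{\|a\|_{L_{2p}(\sigma)}\,\|b\|_{L_{2p}(\sigma)}}.$$ For $\mathcal N\subset\mathcal M$ one takes $\sigma=\sigma_{\operatorname{tr}}$, and for $\mathbb M_n(\mathcal N)\subset\mathbb M_n(\mathcal M)$ one takes $\sigma=\sigma^{(n)}_{\operatorname{tr}}:=n^{-1}\mathbf 1_n\otimes\sigma_{\operatorname{tr}}$. Then for every $1\le p\le\infty$ the identification $$\mathbb M_n\big(L_\infty^p(\mathcal N\subset\mathcal M)\big)\cong L_\infty^p\big(\mathbb M_n(\mathcal N)\subset\mathbb M_n(\mathcal M)\big),\qquad n\in\mathbb N,$$ defines an operator space structure on $L_\infty^p(\mathcal N\subset\mathcal M)$. That is: the suprema defining $\|\cdot\|_{\mathbb M_n}:=\|\cdot\|_{L_\infty^p(\mathbb M_n(\mathcal N)\subset\mathbb M_n(\mathcal M))}$ are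 finite, each $\|\cdot\|_{\mathbb M_n}$ is a norm on $\mathbb M_n(\mathcal M)$, $\|\cdot\|_{\mathbb M_1}$ is the norm of $L_\infty^p(\mathcal N\subset\mathcal M)$, and Ruan's axioms hold: for all $m,n$, (i) $\|v\oplus w\|_{\mathbb M_{m+n}}=\max\{\|v\|_{\mathbb M_m},\|w\|_{\mathbb M_n}\}$ for $v\in\mathbb M_m(\mathcal M)$, $w\in\mathbb M_n(\mathcal M)$; (ii) $\|A\cdot v\cdot B\|_{\mathbb M_n}\le\|A\|\,\|v\|_{\mathbb M_m}\,\|B\|$ for $v\in\mathbb M_m(\mathcal M)$, $A\in\mathbb M_{n,m}(\mathbb C)$, $B\in\mathbb M_{m,n}(\mathbb C)$, where $\|A\|,\|B\|$ are operator norms. -/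

import Mathlib

open scoped ENNReal Matrix Kronecker ComplexOrder

noncomputable section

namespace AmalgamatedLp

/-! ### Abstract operator spaces -/

/-- The operator norm of a rectangular complex matrix, as a map between Euclidean spaces. -/
def opNorm {m n : Type*} [Fintype m] [Fintype n] [DecidableEq n] (A : Matrix m n ℂ) : ℝ :=
  ‖LinearMap.toContinuousLinearMap (Matrix.toEuclideanLin A)‖

/-- The product `A · v · B` of a matrix `v` over a complex vector space with scalar matrices. -/
def scalarMul {V : Type*} [AddCommGroup V] [Module ℂ V] {m n : ℕ}
    (A : Matrix (Fin n) (Fin m) ℂ) (v : Matrix (Fin m) (Fin m) V)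
    (B : Matrix (Fin m) (Fin n) ℂ) : Matrix (Fin n) (Fin n) V :=
  Matrix.of fun i j => ∑ k, ∑ l, (A i k * B l j) • v k l

/-- The block diagonal matrix `v ⊕ w`. -/
def blockSum {V : Type*} [AddCommGroup V] {m n : ℕ}
    (v : Matrix (Fin m) (Fin m) V) (w : Matrix (Fin n) (Fin n) V) :
    Matrix (Fin (m + n)) (Fin (m + n)) V :=
  (Matrix.fromBlocks v 0 0 w).reindex finSumFinEquiv finSumFinEquiv

/-- A family of functions on the spaces `M_n(V)` is an (abstract) operator space structure on the
complex vector space `V` if each of them is a norm and Ruan's two axioms hold. -/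
structure IsOperatorSpaceStructure (V : Type*) [AddCommGroup V] [Module ℂ V]
    (nrm : ∀ n : ℕ, Matrix (Fin n) (Fin n) V → ℝ) : Prop where
  nonneg : ∀ n v, 0 ≤ nrm n v
  eq_zero_iff : ∀ n v, nrm n v = 0 ↔ v = 0
  smul : ∀ n (c : ℂ) v, nrm n (c • v) = ‖c‖ * nrm n v
  add_le : ∀ n v w, nrm n (v + w) ≤ nrm n v + nrm n w
  ruan_blockSum : ∀ (m n : ℕ) (v : Matrix (Fin m) (Fin m) V) (w : Matrix (Fin n) (Fin n) V),
    nrm (m + n) (blockSum v w) = max (nrm m v) (nrm n w)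
  ruan_mul : ∀ (m n : ℕ) (A : Matrix (Fin n) (Fin m) ℂ) (v : Matrix (Fin m) (Fin m) V)
    (B : Matrix (Fin m) (Fin n) ℂ),
    nrm n (scalarMul A v B) ≤ opNorm A * nrm m v * opNorm B

/-! ### Matrix amplifications of a von Neumann algebra

A von Neumann algebra on the Hilbert space `ℂ^ι`, with `ι` finite, is a unital star subalgebra of
`Matrix ι ι ℂ`. -/

section Amplification

variable {ι : Type*} [Fintype ι] [DecidableEq ι]

/-- The `(i, j)` block of an operator on `ℂⁿ ⊗ ℂ^ι`. -/
def blk {n : ℕ} (X : Matrix (Fin n × ι) (Fin n × ι) ℂ) (i j : Fin n) : Matrix ι ι ℂ :=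
  Matrix.of fun a b => X (i, a) (j, b)

/-- The von Neumann algebra `M_n(S)` acting on `ℂⁿ ⊗ ℂ^ι`: operators with all blocks in `S`. -/
def matrixAlgebra (n : ℕ) (S : StarSubalgebra ℂ (Matrix ι ι ℂ)) :
    StarSubalgebra ℂ (Matrix (Fin n × ι) (Fin n × ι) ℂ) where
  carrier := {X | ∀ i j, blk X i j ∈ S}
  mul_mem' := by
    intro X Y hX hY i j
    have h : blk (X * Y) i j = ∑ k, blk X i k * blk Y k j := by
      ext a b
      simp [blk, Matrix.mul_apply, Matrix.sum_apply, Fintype.sum_prod_type]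
    rw [h]
    exact sum_mem fun k _ => mul_mem (hX i k) (hY k j)
  add_mem' := by
    intro X Y hX hY i j
    exact add_mem (hX i j) (hY i j)
  algebraMap_mem' := by
    intro c i j
    by_cases hij : i = j
    · subst hij
      have h : blk (algebraMap ℂ (Matrix (Fin n × ι) (Fin n × ι) ℂ) c) i i
          = algebraMap ℂ (Matrix ι ι ℂ) c := by
        ext a b
        simp [blk, Matrix.algebraMap_matrix_apply]
      rw [h]
      exact S.algebraMap_mem c
    · have h : blk (algebraMap ℂ (Matrix (Fin n × ι) (Fin n × ι) ℂ) c) i j = 0 := by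
        ext a b
        simp [blk, Matrix.algebraMap_matrix_apply, hij]
      rw [h]
      exact zero_mem S
  star_mem' := by
    intro X hX i j
    exact star_mem (hX j i)

/-- The canonical identification of matrices with entries in `S` and elements of `M_n(S)`. -/
def matrixIdent (n : ℕ) (S : StarSubalgebra ℂ (Matrix ι ι ℂ)) :
    Matrix (Fin n) (Fin n) S ≃ₗ[ℂ] matrixAlgebra n S where
  toFun v := ⟨Matrix.of fun x y => (v x.1 y.1 : Matrix ι ι ℂ) x.2 y.2,
    fun i j => (v i j).2⟩
  invFun X := Matrix.of fun i j => ⟨blk X.1 i j, X.2 i j⟩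
  map_add' _ _ := rfl
  map_smul' _ _ := rfl
  left_inv _ := rfl
  right_inv _ := rfl

/-! ### Conditional expectations and the invariant state -/

/-- `E : M → N` is a conditional expectation: a completely positive unital map which is the
identity on `N` and an `N`-bimodule map. -/
structure IsConditionalExpectation {N M : StarSubalgebra ℂ (Matrix ι ι ℂ)} (h : N ≤ M)
    (E : M →ₗ[ℂ] N) : Prop where
  map_one : E 1 = 1
  completelyPositive : ∀ (n : ℕ) (X : Matrix (Fin n) (Fin n) M),
    (matrixIdent n M X).1.PosSemidef → (matrixIdent n N (X.map E)).1.PosSemidef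
  map_inclusion : ∀ x : N, E (StarSubalgebra.inclusion h x) = x
  map_bimodule : ∀ (a b : N) (X : M),
    E (StarSubalgebra.inclusion h a * X * StarSubalgebra.inclusion h b) = a * E X * b

/-- The bilinear form `(X, Y) ↦ tr(X Y)` on `M`. -/
def trForm (M : StarSubalgebra ℂ (Matrix ι ι ℂ)) : LinearMap.BilinForm ℂ M :=
  LinearMap.mk₂ ℂ (fun X Y : M => Matrix.trace ((X : Matrix ι ι ℂ) * (Y : Matrix ι ι ℂ)))
    (by intros; simp [add_mul]) (by intros; simp)
    (by intros; simp [mul_add]) (by intros; simp)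

lemma nondegenerate_trForm (M : StarSubalgebra ℂ (Matrix ι ι ℂ)) :
    (trForm M).Nondegenerate := by
  have key : ∀ X : M, Matrix.trace ((X : Matrix ι ι ℂ)ᴴ * (X : Matrix ι ι ℂ)) = 0 → X = 0 := by
    intro X h
    exact Subtype.ext (Matrix.trace_conjTranspose_mul_self_eq_zero_iff.mp h)
  refine ⟨fun X h => key X ?_, fun X h => key X ?_⟩
  · rw [Matrix.trace_mul_comm]
    exact h (star X)
  · exact h (star X)

instance finiteDimensional_subalgebra (M : StarSubalgebra ℂ (Matrix ι ι ℂ)) :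
    FiniteDimensional ℂ M :=
  FiniteDimensional.of_injective (M.subtype.toAlgHom.toLinearMap) Subtype.val_injective

/-- The adjoint `E_* : M → M` of `E : M → N ⊆ M` with respect to the trace pairing. -/
def traceAdjoint {N M : StarSubalgebra ℂ (Matrix ι ι ℂ)} (h : N ≤ M) (E : M →ₗ[ℂ] N) :
    M →ₗ[ℂ] M :=
  (trForm M).leftAdjointOfNondegenerate (nondegenerate_trForm M)
    ((StarSubalgebra.inclusion h).toAlgHom.toLinearMap ∘ₗ E)

/-- The defining property `tr(E_*(X) Y) = tr(X E(Y))`. -/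
lemma trace_traceAdjoint_mul {N M : StarSubalgebra ℂ (Matrix ι ι ℂ)} (h : N ≤ M)
    (E : M →ₗ[ℂ] N) (X Y : M) :
    Matrix.trace ((traceAdjoint h E X : Matrix ι ι ℂ) * (Y : Matrix ι ι ℂ))
      = Matrix.trace ((X : Matrix ι ι ℂ) * (E Y : Matrix ι ι ℂ)) :=
  LinearMap.BilinForm.isAdjointPairLeftAdjointOfNondegenerate _ (nondegenerate_trForm M)
    ((StarSubalgebra.inclusion h).toAlgHom.toLinearMap ∘ₗ E) X Y

/-- The invariant state `σ_tr = E_*(1 / tr 1)`. -/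
def invariantState {N M : StarSubalgebra ℂ (Matrix ι ι ℂ)} (h : N ≤ M) (E : M →ₗ[ℂ] N) :
    Matrix ι ι ℂ :=
  (traceAdjoint h E ((Matrix.trace (1 : Matrix ι ι ℂ))⁻¹ • (1 : M)) : M)

/-- The state `n⁻¹ 1_n ⊗ σ` on `ℂⁿ ⊗ ℂ^ι`. -/
def ampState (n : ℕ) (σ : Matrix ι ι ℂ) : Matrix (Fin n × ι) (Fin n × ι) ℂ :=
  (n : ℂ)⁻¹ • ((1 : Matrix (Fin n) (Fin n) ℂ) ⊗ₖ σ)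

end Amplification

/-! ### Weighted and amalgamated `L_p` norms -/

section Norms

variable {κ : Type*} [Fintype κ] [DecidableEq κ]

/-- The power `A ^ s` of a positive semidefinite matrix, by functional calculus. -/
def mpow (A : Matrix κ κ ℂ) (s : ℝ) : Matrix κ κ ℂ :=
  cfc (fun t : ℝ => t ^ s) A

/-- The absolute value `|x| = (x† x)^(1/2)`. -/
def matAbs (x : Matrix κ κ ℂ) : Matrix κ κ ℂ :=
  mpow (xᴴ * x) (1 / 2)

/-- The weighted norm `‖x‖_{L_p(σ)} = (tr |σ^(1/2p) x σ^(1/2p)|^p)^(1/p)`, which is the operator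
norm for `p = ∞`. -/
def lpNorm (σ : Matrix κ κ ℂ) (p : ℝ≥0∞) (x : Matrix κ κ ℂ) : ℝ :=
  if p = ∞ then opNorm x
  else
    (Matrix.trace (mpow (matAbs (mpow σ (1 / (2 * p.toReal)) * x * mpow σ (1 / (2 * p.toReal))))
      p.toReal)).re ^ (1 / p.toReal)

/-- The quotients `‖a y b‖_{L_p(σ)} / (‖a‖_{L_{2p}(σ)} ‖b‖_{L_{2p}(σ)})` with nonzero
`a, b ∈ N`. -/
def amalgamatedQuotients (N : StarSubalgebra ℂ (Matrix κ κ ℂ)) (σ : Matrix κ κ ℂ) (p : ℝ≥0∞)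
    (y : Matrix κ κ ℂ) : Set ℝ :=
  {r | ∃ a ∈ N, ∃ b ∈ N, a ≠ 0 ∧ b ≠ 0 ∧
    r = lpNorm σ p (a * y * b) / (lpNorm σ (2 * p) a * lpNorm σ (2 * p) b)}

/-- The amalgamated norm of `L_∞^p(N ⊂ M)` with respect to the state `σ`: here `q = ∞`, so that
`1/r = |1/q - 1/p|` gives `r = p`, and the norm is a supremum over `N`. -/
def amalgamatedNorm (N M : StarSubalgebra ℂ (Matrix κ κ ℂ)) (σ : Matrix κ κ ℂ) (p : ℝ≥0∞)
    (y : M) : ℝ :=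
  sSup (amalgamatedQuotients N σ p y)

end Norms

/-- The norm on `M_n(L_∞^p(N ⊂ M))` given by the identification with
`L_∞^p(M_n(N) ⊂ M_n(M))`, the latter with respect to the state `n⁻¹ 1_n ⊗ σ`. -/
def matrixNorm {ι : Type*} [Fintype ι] [DecidableEq ι] (N M : StarSubalgebra ℂ (Matrix ι ι ℂ))
    (σ : Matrix ι ι ℂ) (p : ℝ≥0∞) (n : ℕ) (v : Matrix (Fin n) (Fin n) M) : ℝ :=
  amalgamatedNorm (matrixAlgebra n N) (matrixAlgebra n M) (ampState n σ) p (matrixIdent n M v)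

end AmalgamatedLp

end

/-! The bimodule property of `E` and cyclicity of the trace show that σ = `invariantState` commutes
with N, and that σ restricted to N is c times the trace (`exists_isTracialWeight`). For p < ∞ the
weight can therefore be moved past a, b ∈ N: with z = σ^(1/2p) y σ^(1/2p) one gets ‖ayb‖_{L_p(σ)} =
‖azb‖_p and ‖a‖_{L_2p(σ)} = c^(1/2p) ‖a‖_{2p} in ordinary Schatten norms. By polar decomposition it
suffices to test positive a and b, so C ≥ 0 bounds all the quotients iff ‖P^(1/2p) z Q^(1/2p)‖_p ≤ C
c^(1/p) (tr P · tr Q)^(1/2p) for positive definite P, Q ∈ N (`HasBound`). On level n the factor n⁻¹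
of the state cancels, so the criterion has the same constant on every level
(`IsTracialWeight.quotients_amp_le_iff`).

Axiom (ii) holds because A ⊗ 1 commutes with the weight and can be absorbed into a: the product a(A
⊗ 1) is rectangular, but its Gram matrix stays in the algebra, and its 2p-norm grows by at most ‖A‖
(`HasBound.mul_mul`). The inequality ≥ in (i) is (ii) for the two coordinate isometries.

The substance is ≤ in (i), `IsDecomposition.hasBound_diagSum`, since P and Q need not be block
diagonal. Let D_P, D_Q be their block diagonal parts, r = 1/2p and X = D_P^r (z₁ ⊕ z₂) D_Q^r. Then
P^r (z₁ ⊕ z₂) Q^r = P^r D_P^(-r) X D_Q^(-r) Q^r has p-norm at most ‖X‖_p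
(`schatten_compression_le`). Since X is block diagonal, ‖X‖_p^p is the sum over the two blocks, and
Cauchy–Schwarz recombines the traces.

The compression estimate is the three lines theorem (`norm_trace_compression_le`): on Re s = 0 the
powers of P and D_P are unitary, and on Re s = 1 the identity tr(P VV†) = tr(D_P VV†) for block
diagonal V controls Hilbert–Schmidt norms. The same theorem with trivial compressions is Hölder's
inequality, from which Minkowski and the ideal property follow by duality. For p = ∞ the amalgamated
norm is just the operator norm. -/

noncomputable section

namespace AmalgamatedLp

open Matrix

set_option linter.unusedSectionVars false

/-! ### The operator norm -/

section OpNorm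

variable {l m n : Type*} [Fintype l] [Fintype m] [Fintype n]
  [DecidableEq l] [DecidableEq m] [DecidableEq n]

open scoped Matrix.Norms.L2Operator in
lemma opNorm_eq_norm (A : Matrix m n ℂ) : opNorm A = ‖A‖ := rfl

lemma opNorm_nonneg (A : Matrix m n ℂ) : 0 ≤ opNorm A := norm_nonneg _

lemma opNorm_zero : opNorm (0 : Matrix m n ℂ) = 0 := by
  open scoped Matrix.Norms.L2Operator in
  simpa only [opNorm_eq_norm] using norm_zero

lemma opNorm_eq_zero {A : Matrix m n ℂ} : opNorm A = 0 ↔ A = 0 := by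
  open scoped Matrix.Norms.L2Operator in
  simpa only [opNorm_eq_norm] using norm_eq_zero

lemma opNorm_add_le (A B : Matrix m n ℂ) : opNorm (A + B) ≤ opNorm A + opNorm B := by
  open scoped Matrix.Norms.L2Operator in
  simpa only [opNorm_eq_norm] using norm_add_le A B

lemma opNorm_smul (c : ℂ) (A : Matrix m n ℂ) : opNorm (c • A) = ‖c‖ * opNorm A := by
  open scoped Matrix.Norms.L2Operator in
  simpa only [opNorm_eq_norm] using norm_smul c A

lemma opNorm_mul_le (A : Matrix l m ℂ) (B : Matrix m n ℂ) :
    opNorm (A * B) ≤ opNorm A * opNorm B := by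
  open scoped Matrix.Norms.L2Operator in
  simpa only [opNorm_eq_norm] using l2_opNorm_mul A B

lemma opNorm_conjTranspose (A : Matrix m n ℂ) : opNorm Aᴴ = opNorm A := by
  open scoped Matrix.Norms.L2Operator in
  simpa only [opNorm_eq_norm] using l2_opNorm_conjTranspose A

/-- The square of the Euclidean norm of a vector. -/
def vecSq (v : n → ℂ) : ℝ := ∑ i, ‖v i‖ ^ 2

lemma vecSq_eq_norm (v : n → ℂ) : vecSq v = ‖WithLp.toLp 2 v‖ ^ 2 := by
  rw [EuclideanSpace.norm_sq_eq]; rfl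

lemma ofReal_vecSq (v : n → ℂ) : (vecSq v : ℂ) = star v ⬝ᵥ v := by
  simp [vecSq, dotProduct, Complex.conj_mul']

lemma vecSq_mulVec_le (A : Matrix m n ℂ) (v : n → ℂ) :
    vecSq (A *ᵥ v) ≤ opNorm A ^ 2 * vecSq v := by
  open scoped Matrix.Norms.L2Operator in
  rw [vecSq_eq_norm, vecSq_eq_norm, ← mul_pow]
  exact pow_le_pow_left₀ (norm_nonneg _) (l2_opNorm_mulVec A (WithLp.toLp 2 v)) 2

lemma opNorm_le_of_vecSq {A : Matrix m n ℂ} {C : ℝ} (hC : 0 ≤ C)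
    (h : ∀ v, vecSq (A *ᵥ v) ≤ C ^ 2 * vecSq v) : opNorm A ≤ C := by
  refine ContinuousLinearMap.opNorm_le_bound _ hC fun x => ?_
  refine (sq_le_sq₀ (norm_nonneg _) (by positivity)).mp ?_
  have := h x.ofLp
  rw [vecSq_eq_norm, vecSq_eq_norm] at this
  rw [mul_pow]
  exact this

lemma vecSq_mulVec_eq (A : Matrix m n ℂ) (v : n → ℂ) :
    (vecSq (A *ᵥ v) : ℂ) = star v ⬝ᵥ ((Aᴴ * A) *ᵥ v) := by
  rw [ofReal_vecSq, star_mulVec, ← dotProduct_mulVec, mulVec_mulVec]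

/-- Together with its converse `posSemidef_of_opNorm_le`, this turns norm bounds into positivity of
C² - A†A, a form that passes directly to block sums and to Kronecker products with 1. -/
lemma opNorm_le_of_posSemidef {A : Matrix m n ℂ} {C : ℝ} (hC : 0 ≤ C)
    (h : (((C ^ 2 : ℝ) : ℂ) • (1 : Matrix n n ℂ) - Aᴴ * A).PosSemidef) : opNorm A ≤ C := by
  refine opNorm_le_of_vecSq hC fun v => ?_
  have h1 := h.dotProduct_mulVec_nonneg v
  rw [sub_mulVec, dotProduct_sub, ← vecSq_mulVec_eq, smul_mulVec, one_mulVec, dotProduct_smul,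
    ← ofReal_vecSq, smul_eq_mul, sub_nonneg] at h1
  exact_mod_cast h1

lemma posSemidef_of_opNorm_le {A : Matrix m n ℂ} {C : ℝ} (h : opNorm A ≤ C) :
    (((C ^ 2 : ℝ) : ℂ) • (1 : Matrix n n ℂ) - Aᴴ * A).PosSemidef := by
  refine PosSemidef.of_dotProduct_mulVec_nonneg ?_ fun v => ?_
  · simp [IsHermitian, conjTranspose_sub, conjTranspose_smul]
  · rw [sub_mulVec, dotProduct_sub, ← vecSq_mulVec_eq, smul_mulVec, one_mulVec, dotProduct_smul,
      ← ofReal_vecSq, smul_eq_mul, sub_nonneg]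
    have h2 : vecSq (A *ᵥ v) ≤ C ^ 2 * vecSq v := by
      refine (vecSq_mulVec_le A v).trans ?_
      have := opNorm_nonneg A
      have : 0 ≤ vecSq v := by unfold vecSq; positivity
      gcongr
    exact_mod_cast h2

lemma opNorm_one_le : opNorm (1 : Matrix n n ℂ) ≤ 1 :=
  opNorm_le_of_vecSq zero_le_one fun v => by simp

/-- A matrix `A` with `A† A` idempotent is a partial isometry, hence a contraction. -/
lemma opNorm_le_one_of_idempotent {A : Matrix m n ℂ} (h : (Aᴴ * A) * (Aᴴ * A) = Aᴴ * A) :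
    opNorm A ≤ 1 := by
  refine opNorm_le_of_posSemidef zero_le_one ?_
  have h1 : (((1 ^ 2 : ℝ) : ℂ) • (1 : Matrix n n ℂ) - Aᴴ * A)
      = (1 - Aᴴ * A)ᴴ * (1 - Aᴴ * A) := by
    simp [conjTranspose_sub, sub_mul, mul_sub, h]
  rw [h1]
  exact posSemidef_conjTranspose_mul_self _

lemma opNorm_le_one_of_isometry {A : Matrix m n ℂ} (h : Aᴴ * A = 1) : opNorm A ≤ 1 :=
  opNorm_le_one_of_idempotent (by simp [h])

lemma opNorm_mul_le_one {A : Matrix l m ℂ} {B : Matrix m n ℂ} (hA : opNorm A ≤ 1)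
    (hB : opNorm B ≤ 1) : opNorm (A * B) ≤ 1 :=
  (opNorm_mul_le A B).trans (mul_le_one₀ hA (opNorm_nonneg B) hB)

end OpNorm

/-! ### The Hilbert--Schmidt norm -/

section HilbertSchmidt

variable {l m n : Type*} [Fintype l] [Fintype m] [Fintype n]
  [DecidableEq l] [DecidableEq m] [DecidableEq n]

/-- The square of the Hilbert--Schmidt norm. -/
def hsSq (X : Matrix m n ℂ) : ℝ := ∑ i, ∑ j, ‖X i j‖ ^ 2

lemma ofReal_hsSq (X : Matrix m n ℂ) : (hsSq X : ℂ) = trace (Xᴴ * X) := by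
  rw [hsSq, Finset.sum_comm]
  simp [trace, mul_apply, Complex.conj_mul']

lemma hsSq_conjTranspose (X : Matrix m n ℂ) : hsSq Xᴴ = hsSq X := by
  rw [hsSq, hsSq, Finset.sum_comm]
  simp

lemma hsSq_eq_sum_vecSq (X : Matrix m n ℂ) : hsSq X = ∑ j, vecSq (fun i => X i j) := by
  rw [hsSq, Finset.sum_comm]; rfl

lemma hsSq_mul_le (A : Matrix l m ℂ) (X : Matrix m n ℂ) (hA : opNorm A ≤ 1) :
    hsSq (A * X) ≤ hsSq X := by
  rw [hsSq_eq_sum_vecSq, hsSq_eq_sum_vecSq]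
  refine Finset.sum_le_sum fun j _ => ?_
  refine (vecSq_mulVec_le A (fun i => X i j)).trans ?_
  have := opNorm_nonneg A
  have h2 : 0 ≤ vecSq (fun i => X i j) := by unfold vecSq; positivity
  exact mul_le_of_le_one_left h2 (pow_le_one₀ this hA)

lemma norm_trace_mul_le (A : Matrix m n ℂ) (B : Matrix n m ℂ) :
    ‖trace (A * B)‖ ≤ √(hsSq A) * √(hsSq B) := by
  have h1 : ‖trace (A * B)‖ ≤ ∑ x : m × n, ‖A x.1 x.2‖ * ‖B x.2 x.1‖ := by
    rw [trace, Fintype.sum_prod_type]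
    refine (norm_sum_le _ _).trans (Finset.sum_le_sum fun i _ => ?_)
    rw [diag_apply, mul_apply]
    refine (norm_sum_le _ _).trans (Finset.sum_le_sum fun j _ => ?_)
    exact norm_mul_le _ _
  refine h1.trans ((Real.sum_mul_le_sqrt_mul_sqrt _ _ _).trans (le_of_eq ?_))
  congr 2
  · rw [Fintype.sum_prod_type]; rfl
  · rw [Fintype.sum_prod_type, hsSq, Finset.sum_comm]

end HilbertSchmidt

/-! ### Complex functions of Hermitian matrices -/

section FunctionalCalculus

variable {m n : Type*} [Fintype m] [Fintype n] [DecidableEq m] [DecidableEq n]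

/-- The value at a Hermitian matrix of a complex function on the real line. -/
def fc {A : Matrix n n ℂ} (hA : A.IsHermitian) (f : ℝ → ℂ) : Matrix n n ℂ :=
  (hA.eigenvectorUnitary : Matrix n n ℂ) * diagonal (fun i => f (hA.eigenvalues i)) *
    star (hA.eigenvectorUnitary : Matrix n n ℂ)

variable {A : Matrix n n ℂ} (hA : A.IsHermitian)

lemma fc_mul (f g : ℝ → ℂ) : fc hA f * fc hA g = fc hA (fun t => f t * g t) := by
  have h : star (hA.eigenvectorUnitary : Matrix n n ℂ) * (hA.eigenvectorUnitary : Matrix n n ℂ) = 1 :=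
    Unitary.coe_star_mul_self _
  unfold fc
  rw [← diagonal_mul_diagonal]
  simp only [Matrix.mul_assoc]
  rw [← Matrix.mul_assoc (star _) (hA.eigenvectorUnitary : Matrix n n ℂ), h, Matrix.one_mul]

lemma fc_add (f g : ℝ → ℂ) : fc hA f + fc hA g = fc hA (fun t => f t + g t) := by
  unfold fc
  rw [← diagonal_add, Matrix.mul_add, Matrix.add_mul]

lemma fc_const (c : ℂ) : fc hA (fun _ => c) = algebraMap ℂ _ c := by
  have h : (hA.eigenvectorUnitary : Matrix n n ℂ) * star (hA.eigenvectorUnitary : Matrix n n ℂ) = 1 :=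
    Unitary.coe_mul_star_self _
  unfold fc
  rw [← smul_one_eq_diagonal, Matrix.mul_smul, Matrix.smul_mul, Matrix.mul_one, h,
    Algebra.algebraMap_eq_smul_one]

lemma fc_one : fc hA (fun _ => 1) = 1 := by rw [fc_const, map_one]

lemma fc_conjTranspose (f : ℝ → ℂ) : (fc hA f)ᴴ = fc hA (fun t => star (f t)) := by
  unfold fc
  simp only [conjTranspose_mul, diagonal_conjTranspose, star_eq_conjTranspose,
    conjTranspose_conjTranspose, Matrix.mul_assoc]
  rfl

lemma fc_congr {f g : ℝ → ℂ} (h : ∀ i, f (hA.eigenvalues i) = g (hA.eigenvalues i)) :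
    fc hA f = fc hA g := by
  simp only [fc, h]

lemma fc_ofReal (f : ℝ → ℝ) : fc hA (fun t => (f t : ℂ)) = cfc f A := by
  rw [hA.cfc_eq, IsHermitian.cfc, Unitary.conjStarAlgAut_apply]
  rfl

lemma fc_id : fc hA (fun t => (t : ℂ)) = A := by
  rw [fc_ofReal hA (fun t => t)]
  exact cfc_id' ℝ A (show IsSelfAdjoint A from hA)

lemma trace_fc (f : ℝ → ℂ) : trace (fc hA f) = ∑ i, f (hA.eigenvalues i) := by
  have h : star (hA.eigenvectorUnitary : Matrix n n ℂ) * (hA.eigenvectorUnitary : Matrix n n ℂ) = 1 :=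
    Unitary.coe_star_mul_self _
  rw [fc, trace_mul_comm, ← Matrix.mul_assoc, h, Matrix.one_mul, trace_diagonal]

lemma fc_polynomial (P : Polynomial ℂ) :
    fc hA (fun t => P.eval (t : ℂ)) = Polynomial.aeval A P := by
  induction P using Polynomial.induction_on' with
  | add p q hp hq => simp only [Polynomial.eval_add, ← fc_add, hp, hq, map_add]
  | monomial k a =>
    have hk : ∀ k : ℕ, fc hA (fun t => (t : ℂ) ^ k) = A ^ k := by
      intro k
      induction k with
      | zero => simp [fc_one]
      | succ k ih => simp only [pow_succ, ← fc_mul, ih, fc_id]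
    simp only [Polynomial.eval_monomial, Polynomial.aeval_monomial]
    rw [← fc_mul, fc_const, hk]

/-- Lagrange interpolation on the union of both spectra gives one polynomial that serves both
matrices. This reduces intertwining relations and membership in subalgebras to polynomials. -/
lemma exists_polynomial_fc {B : Matrix m m ℂ} (hB : B.IsHermitian) (f : ℝ → ℂ) :
    ∃ P : Polynomial ℂ, fc hA f = Polynomial.aeval A P ∧ fc hB f = Polynomial.aeval B P := by
  classical
  let S : Finset ℝ := Finset.univ.image hA.eigenvalues ∪ Finset.univ.image hB.eigenvalues
  let P : Polynomial ℂ := Lagrange.interpolate S (fun t : ℝ => (t : ℂ)) f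
  have hP : ∀ t ∈ S, P.eval (t : ℂ) = f t := fun t ht =>
    Lagrange.eval_interpolate_at_node f (fun _ _ _ _ h => Complex.ofReal_injective h) ht
  refine ⟨P, ?_, ?_⟩
  · rw [← fc_polynomial hA]
    exact fc_congr hA fun i => (hP _ (by simp [S])).symm
  · rw [← fc_polynomial hB]
    exact fc_congr hB fun i => (hP _ (by simp [S])).symm

/-- Functions of Hermitian matrices are intertwined by every matrix intertwining the arguments. -/
lemma fc_intertwine {B : Matrix m m ℂ} (hB : B.IsHermitian) {J : Matrix n m ℂ}
    (h : A * J = J * B) (f : ℝ → ℂ) : fc hA f * J = J * fc hB f := by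
  obtain ⟨P, h1, h2⟩ := exists_polynomial_fc hA hB f
  rw [h1, h2]
  clear h1 h2
  induction P using Polynomial.induction_on' with
  | add p q hp hq => simp only [map_add, Matrix.add_mul, Matrix.mul_add, hp, hq]
  | monomial k a =>
    have hk : ∀ k : ℕ, A ^ k * J = J * B ^ k := by
      intro k
      induction k with
      | zero => simp
      | succ k ih => rw [pow_succ, Matrix.mul_assoc, h, ← Matrix.mul_assoc, ih, pow_succ,
          Matrix.mul_assoc]
    rw [Polynomial.aeval_monomial, Polynomial.aeval_monomial, Algebra.algebraMap_eq_smul_one,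
      Algebra.algebraMap_eq_smul_one, smul_mul_assoc, smul_mul_assoc, one_mul, one_mul,
      Matrix.smul_mul, Matrix.mul_smul, hk]

lemma fc_mem {S : StarSubalgebra ℂ (Matrix n n ℂ)} (h : A ∈ S) (f : ℝ → ℂ) : fc hA f ∈ S := by
  obtain ⟨P, h1, -⟩ := exists_polynomial_fc hA hA f
  rw [h1]
  exact Algebra.adjoin_le (S := S.toSubalgebra) (Set.singleton_subset_iff.mpr h)
    (Polynomial.aeval_mem_adjoin_singleton ℂ A)

lemma fc_apply (f : ℝ → ℂ) (i j : n) : fc hA f i j =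
    ∑ k, f (hA.eigenvalues k) * ((hA.eigenvectorUnitary : Matrix n n ℂ) i k *
      star ((hA.eigenvectorUnitary : Matrix n n ℂ) j k)) := by
  rw [fc, mul_apply]
  refine Finset.sum_congr rfl fun k _ => ?_
  rw [mul_diagonal, star_apply]
  ring

end FunctionalCalculus

/-! ### Complex powers -/

/-- The complex power `t ^ s` of a real number `t ≥ 0`, with `0 ^ s = 0` for all `s`. -/
def pw (s : ℂ) (t : ℝ) : ℂ := if t = 0 then 0 else Complex.exp (s * Real.log t)

lemma pw_mul (s r : ℂ) (t : ℝ) : pw s t * pw r t = pw (s + r) t := by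
  unfold pw
  split_ifs with h
  · simp
  · rw [add_mul, Complex.exp_add]

lemma star_pw (s : ℂ) (t : ℝ) : star (pw s t) = pw (star s) t := by
  unfold pw
  split_ifs with h
  · simp
  · simp [← Complex.exp_conj]

lemma pw_ofReal_of_pos (r : ℝ) {t : ℝ} (ht : 0 < t) : pw r t = (t ^ r : ℝ) := by
  rw [pw, if_neg ht.ne', Real.rpow_def_of_pos ht]
  push_cast
  rw [mul_comm]

/-- The exponent 0 is excluded because `Real.rpow` has 0 ^ 0 = 1 whereas `pw 0 0 = 0`. The
convention for `pw` makes `fc hA (pw 0)` the support projection of a positive semidefinite A and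
makes `pw_mul` hold without exceptions. -/
lemma pw_ofReal {r : ℝ} (hr : r ≠ 0) {t : ℝ} (ht : 0 ≤ t) : pw r t = (t ^ r : ℝ) := by
  rcases ht.eq_or_lt with rfl | h
  · simp [pw, Real.zero_rpow hr]
  · exact pw_ofReal_of_pos r h

lemma pw_zero_of_pos {t : ℝ} (ht : 0 < t) : pw 0 t = 1 := by
  simp [pw, ht.ne']

lemma pw_one {t : ℝ} (ht : 0 ≤ t) : pw 1 t = t := by
  have := pw_ofReal one_ne_zero ht
  simpa using this

lemma differentiable_pw (t : ℝ) : Differentiable ℂ (fun s => pw s t) := by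
  unfold pw
  split_ifs with h
  · exact differentiable_const _
  · fun_prop

lemma norm_pw_le (s : ℂ) (t : ℝ) : ‖pw s t‖ ≤ Real.exp (|s.re| * |Real.log t|) := by
  unfold pw
  split_ifs with h
  · simp [Real.exp_nonneg]
  · rw [Complex.norm_exp, Real.exp_le_exp]
    simp only [Complex.mul_re, Complex.ofReal_re, Complex.ofReal_im, mul_zero, sub_zero]
    exact (le_abs_self _).trans (abs_mul _ _).le

section Powers

variable {m n : Type*} [Fintype m] [Fintype n] [DecidableEq m] [DecidableEq n]

lemma mpow_eq_fc {A : Matrix n n ℂ} (hA : A.IsHermitian) (r : ℝ) :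
    mpow A r = fc hA (fun t => ((t ^ r : ℝ) : ℂ)) := (fc_ofReal hA _).symm

lemma mpow_eq_fc_pw {A : Matrix n n ℂ} (hA : A.PosSemidef) {r : ℝ} (hr : r ≠ 0) :
    mpow A r = fc hA.1 (pw r) := by
  rw [mpow_eq_fc hA.1]
  exact fc_congr _ fun i => (pw_ofReal hr (hA.eigenvalues_nonneg i)).symm

lemma mpow_eq_fc_pw_of_posDef {A : Matrix n n ℂ} (hA : A.PosDef) (r : ℝ) :
    mpow A r = fc hA.1 (pw r) := by
  rw [mpow_eq_fc hA.1]
  exact fc_congr _ fun i => (pw_ofReal_of_pos r (hA.eigenvalues_pos i)).symm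

lemma fc_pw_mul {A : Matrix n n ℂ} (hA : A.IsHermitian) (s r : ℂ) :
    fc hA (pw s) * fc hA (pw r) = fc hA (pw (s + r)) := by
  rw [fc_mul]
  simp only [pw_mul]

lemma fc_pw_conjTranspose {A : Matrix n n ℂ} (hA : A.IsHermitian) (s : ℂ) :
    (fc hA (pw s))ᴴ = fc hA (pw (star s)) := by
  rw [fc_conjTranspose]
  simp only [star_pw]

lemma fc_pw_one {A : Matrix n n ℂ} (hA : A.PosSemidef) : fc hA.1 (pw 1) = A := by
  conv_rhs => rw [← fc_id hA.1]
  exact fc_congr _ fun i => pw_one (hA.eigenvalues_nonneg i)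

lemma fc_pw_zero {A : Matrix n n ℂ} (hA : A.PosDef) : fc hA.1 (pw 0) = 1 := by
  rw [← fc_one hA.1]
  exact fc_congr _ fun i => pw_zero_of_pos (hA.eigenvalues_pos i)

lemma mpow_intertwine {A : Matrix n n ℂ} {B : Matrix m m ℂ} (hA : A.IsHermitian)
    (hB : B.IsHermitian) {J : Matrix n m ℂ} (h : A * J = J * B) (r : ℝ) :
    mpow A r * J = J * mpow B r := by
  rw [mpow_eq_fc hA, mpow_eq_fc hB]
  exact fc_intertwine hA hB h _

lemma mpow_mem {A : Matrix n n ℂ} {S : StarSubalgebra ℂ (Matrix n n ℂ)} (hA : A.IsHermitian)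
    (h : A ∈ S) (r : ℝ) : mpow A r ∈ S := by
  rw [mpow_eq_fc hA]
  exact fc_mem hA h _

lemma isHermitian_mpow (A : Matrix n n ℂ) (r : ℝ) : (mpow A r).IsHermitian :=
  cfc_predicate (p := IsSelfAdjoint) _ A

lemma posSemidef_mpow {A : Matrix n n ℂ} (hA : A.PosSemidef) (r : ℝ) : (mpow A r).PosSemidef := by
  have h : mpow A r = (fc hA.1 (fun t => ((t ^ (r / 2) : ℝ) : ℂ)))ᴴ *
      fc hA.1 (fun t => ((t ^ (r / 2) : ℝ) : ℂ)) := by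
    rw [mpow_eq_fc hA.1, fc_conjTranspose, fc_mul]
    refine fc_congr _ fun i => ?_
    have := hA.eigenvalues_nonneg i
    generalize hA.1.eigenvalues i = t at this
    rw [Complex.star_def, Complex.conj_ofReal, ← Complex.ofReal_mul, ← sq,
      ← Real.rpow_mul_natCast this]
    norm_num
  rw [h]
  exact posSemidef_conjTranspose_mul_self _

lemma mpow_mul_mpow {A : Matrix n n ℂ} (hA : A.PosDef) (r s : ℝ) :
    mpow A r * mpow A s = mpow A (r + s) := by
  rw [mpow_eq_fc_pw_of_posDef hA, mpow_eq_fc_pw_of_posDef hA, mpow_eq_fc_pw_of_posDef hA, fc_pw_mul,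
    Complex.ofReal_add]

lemma mpow_zero (A : Matrix n n ℂ) (hA : A.IsHermitian) : mpow A 0 = 1 := by
  rw [mpow_eq_fc hA, ← fc_one hA]
  simp

lemma mpow_one {A : Matrix n n ℂ} (hA : A.IsHermitian) : mpow A 1 = A := by
  rw [mpow_eq_fc hA]
  simp [fc_id]

lemma posDef_mpow {A : Matrix n n ℂ} (hA : A.PosDef) (r : ℝ) : (mpow A r).PosDef := by
  refine (posSemidef_mpow hA.posSemidef r).posDef_iff_isUnit.mpr ?_
  refine IsUnit.of_mul_eq_one (mpow A (-r)) ?_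
  rw [mpow_mul_mpow hA, add_neg_cancel, mpow_zero _ hA.1]

/-- The spectrum is finite, so every function is continuous on it and the composition rule of the
functional calculus applies to exponents of any sign. -/
lemma mpow_mpow {A : Matrix n n ℂ} (hA : A.PosSemidef) (r s : ℝ) :
    mpow (mpow A r) s = mpow A (r * s) := by
  have hfin : (spectrum ℝ A).Finite := finite_real_spectrum
  refine (cfc_comp' (fun t : ℝ => t ^ s) (fun t : ℝ => t ^ r) A
    ((hfin.image _).continuousOn _) (hfin.continuousOn _) hA.1).symm.trans ?_
  refine cfc_congr fun t ht => ?_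
  have h0 : 0 ≤ t := by
    rw [hA.1.spectrum_real_eq_range_eigenvalues] at ht
    obtain ⟨i, rfl⟩ := ht
    exact hA.eigenvalues_nonneg i
  exact (Real.rpow_mul h0 r s).symm

lemma mpow_smul {A : Matrix n n ℂ} (hA : A.PosSemidef) {c : ℝ} (hc : 0 ≤ c) (r : ℝ) :
    mpow ((c : ℂ) • A) r = ((c ^ r : ℝ) : ℂ) • mpow A r := by
  have hfin : (spectrum ℝ A).Finite := finite_real_spectrum
  have h1 : (c : ℂ) • A = cfc (fun t : ℝ => c * t) A := by
    rw [← fc_ofReal hA.1]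
    simp only [Complex.ofReal_mul]
    rw [← fc_mul, fc_id, fc_const, Algebra.algebraMap_eq_smul_one, Matrix.smul_mul, Matrix.one_mul]
  have h2 : ((c ^ r : ℝ) : ℂ) • mpow A r = cfc (fun t : ℝ => c ^ r * t ^ r) A := by
    rw [← fc_ofReal hA.1, mpow_eq_fc hA.1]
    simp only [Complex.ofReal_mul]
    rw [← fc_mul, fc_const, Algebra.algebraMap_eq_smul_one, Matrix.smul_mul, Matrix.one_mul]
  rw [h2, h1, mpow]
  refine (cfc_comp' (fun t : ℝ => t ^ r) (fun t : ℝ => c * t) A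
    ((hfin.image _).continuousOn _) (hfin.continuousOn _) hA.1).symm.trans ?_
  refine cfc_congr fun t ht => ?_
  have h0 : 0 ≤ t := by
    rw [hA.1.spectrum_real_eq_range_eigenvalues] at ht
    obtain ⟨i, rfl⟩ := ht
    exact hA.eigenvalues_nonneg i
  exact Real.mul_rpow hc h0

end Powers

/-! ### Bounded analytic matrix functions on the strip -/

/-- Entire functions which are bounded on the strip `0 ≤ Re s ≤ 1`. -/
structure StripFn (f : ℂ → ℂ) : Prop where
  differentiable : Differentiable ℂ f
  bounded : ∃ C, ∀ s : ℂ, 0 ≤ s.re → s.re ≤ 1 → ‖f s‖ ≤ C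

lemma StripFn.const (c : ℂ) : StripFn fun _ => c :=
  ⟨differentiable_const c, ‖c‖, fun _ _ _ => le_rfl⟩

lemma StripFn.mul {f g : ℂ → ℂ} (hf : StripFn f) (hg : StripFn g) :
    StripFn fun s => f s * g s := by
  obtain ⟨C, hC⟩ := hf.bounded
  obtain ⟨D, hD⟩ := hg.bounded
  refine ⟨hf.differentiable.mul hg.differentiable, C * D, fun s h0 h1 => ?_⟩
  rw [norm_mul]
  have := hC s h0 h1
  exact mul_le_mul this (hD s h0 h1) (norm_nonneg _) ((norm_nonneg _).trans this)

lemma StripFn.sum {κ : Type*} {t : Finset κ} {f : κ → ℂ → ℂ} (hf : ∀ i ∈ t, StripFn (f i)) :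
    StripFn fun s => ∑ i ∈ t, f i s := by
  classical
  induction t using Finset.induction_on with
  | empty => simpa using StripFn.const 0
  | insert a t ha ih =>
    simp only [Finset.sum_insert ha]
    obtain ⟨C, hC⟩ := (hf a (by simp)).bounded
    obtain ⟨D, hD⟩ := (ih fun i hi => hf i (by simp [hi])).bounded
    refine ⟨(hf a (by simp)).differentiable.add (ih fun i hi => hf i (by simp [hi])).differentiable,
      C + D, fun s h0 h1 => ?_⟩
    exact (norm_add_le _ _).trans (add_le_add (hC s h0 h1) (hD s h0 h1))

/-- Hadamard's three lines theorem, evaluated at a real point of the strip. -/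
lemma StripFn.norm_le {f : ℂ → ℂ} (hf : StripFn f) {a b : ℝ} (ha : ∀ s : ℂ, s.re = 0 → ‖f s‖ ≤ a)
    (hb : ∀ s : ℂ, s.re = 1 → ‖f s‖ ≤ b) {r : ℝ} (h0 : 0 ≤ r) (h1 : r ≤ 1) :
    ‖f r‖ ≤ a ^ (1 - r) * b ^ r := by
  obtain ⟨C, hC⟩ := hf.bounded
  have := Complex.HadamardThreeLines.norm_le_interp_of_mem_verticalClosedStrip₀₁' f (z := (r : ℂ))
    (a := a) (b := b) (by simp [Complex.HadamardThreeLines.verticalClosedStrip, h0, h1])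
    hf.differentiable.diffContOnCl
    ⟨C, by rintro _ ⟨s, hs, rfl⟩; exact hC s hs.1 hs.2⟩
    (fun z hz => ha z hz) (fun z hz => hb z hz)
  simpa using this

section StripMat

variable {l m n : Type*} [Fintype l] [Fintype m] [Fintype n]
  [DecidableEq l] [DecidableEq m] [DecidableEq n]

/-- Matrix functions all of whose entries are entire and bounded on the strip. -/
def StripMat (F : ℂ → Matrix m n ℂ) : Prop := ∀ i j, StripFn fun s => F s i j

lemma StripMat.const (A : Matrix m n ℂ) : StripMat fun _ => A := fun _ _ => StripFn.const _

lemma StripMat.mul {F : ℂ → Matrix l m ℂ} {G : ℂ → Matrix m n ℂ} (hF : StripMat F)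
    (hG : StripMat G) : StripMat fun s => F s * G s := fun i j => by
  simp only [mul_apply]
  exact StripFn.sum fun k _ => (hF i k).mul (hG k j)

lemma StripMat.trace {F : ℂ → Matrix n n ℂ} (hF : StripMat F) :
    StripFn fun s => Matrix.trace (F s) :=
  StripFn.sum fun i _ => hF i i

/-- In the eigenbasis each entry is a finite sum of exponentials of an affine function of s, and
their moduli depend only on Re s. -/
lemma stripMat_fc_pw {A : Matrix n n ℂ} (hA : A.IsHermitian) (a b : ℝ) :
    StripMat fun s => fc hA (pw (a * s + b)) := fun i j => by
  simp only [fc_apply]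
  refine StripFn.sum fun k _ => StripFn.mul ?_ (StripFn.const _)
  refine ⟨(differentiable_pw _).comp (by fun_prop),
    Real.exp ((|a| + |b|) * |Real.log (hA.eigenvalues k)|), fun s h0 h1 => ?_⟩
  refine (norm_pw_le _ _).trans ?_
  gcongr
  simp only [Complex.add_re, Complex.mul_re, Complex.ofReal_re, Complex.ofReal_im, zero_mul,
    sub_zero]
  refine (abs_add_le _ _).trans ?_
  rw [abs_mul, abs_of_nonneg h0]
  gcongr
  exact mul_le_of_le_one_right (abs_nonneg _) h1

end StripMat

/-! ### Traces of powers -/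

section TracePower

variable {m n : Type*} [Fintype m] [Fintype n] [DecidableEq m] [DecidableEq n]

/-- The trace of the `r`-th power of a positive semidefinite matrix. -/
def trPow (H : Matrix n n ℂ) (r : ℝ) : ℝ := (trace (mpow H r)).re

lemma trPow_eq_sum {H : Matrix n n ℂ} (hH : H.IsHermitian) (r : ℝ) :
    trPow H r = ∑ i, hH.eigenvalues i ^ r := by
  rw [trPow, mpow_eq_fc hH, trace_fc, Complex.re_sum]
  simp

lemma ofReal_trPow {H : Matrix n n ℂ} (hH : H.IsHermitian) (r : ℝ) :
    (trPow H r : ℂ) = trace (mpow H r) := by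
  rw [trPow_eq_sum hH, mpow_eq_fc hH, trace_fc]
  push_cast
  rfl

lemma trPow_nonneg {H : Matrix n n ℂ} (hH : H.PosSemidef) (r : ℝ) : 0 ≤ trPow H r := by
  rw [trPow_eq_sum hH.1]
  exact Finset.sum_nonneg fun i _ => Real.rpow_nonneg (hH.eigenvalues_nonneg i) r

lemma trPow_eq_zero {H : Matrix n n ℂ} (hH : H.PosSemidef) {r : ℝ} (hr : r ≠ 0) :
    trPow H r = 0 ↔ H = 0 := by
  rw [trPow_eq_sum hH.1, Finset.sum_eq_zero_iff_of_nonneg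
    fun i _ => Real.rpow_nonneg (hH.eigenvalues_nonneg i) r, ← hH.1.eigenvalues_eq_zero_iff]
  constructor
  · intro h
    funext i
    exact (Real.rpow_eq_zero (hH.eigenvalues_nonneg i) hr).mp (h i (Finset.mem_univ i))
  · intro h i _
    rw [h]
    exact Real.zero_rpow hr

lemma fc_pw_mul_self {H : Matrix n n ℂ} (hH : H.PosSemidef) (e : ℂ) :
    fc hH.1 (pw e) * H = fc hH.1 (pw (e + 1)) := by
  rw [← fc_pw_mul, fc_pw_one hH]

/-- With H = X†X, the Gram matrix of X H^e is H^(ē + 1 + e), so only the real part of e matters. -/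
lemma hsSq_mul_fc_pw (X : Matrix m n ℂ) (e : ℂ) {r : ℝ} (hr : r ≠ 0) (he : star e + 1 + e = r) :
    hsSq (X * fc (isHermitian_conjTranspose_mul_self X) (pw e)) = trPow (Xᴴ * X) r := by
  have hP := posSemidef_conjTranspose_mul_self X
  have h : (X * fc (isHermitian_conjTranspose_mul_self X) (pw e))ᴴ *
      (X * fc (isHermitian_conjTranspose_mul_self X) (pw e)) = mpow (Xᴴ * X) r := by
    rw [mpow_eq_fc_pw hP hr, conjTranspose_mul, fc_pw_conjTranspose, Matrix.mul_assoc,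
      ← Matrix.mul_assoc Xᴴ, ← Matrix.mul_assoc, ← he, ← fc_pw_mul, ← fc_pw_mul, fc_pw_one hP]
  have h2 := ofReal_hsSq (X * fc (isHermitian_conjTranspose_mul_self X) (pw e))
  rw [h, ← ofReal_trPow hP.1] at h2
  exact_mod_cast h2

lemma hsSq_fc_pw {H : Matrix n n ℂ} (hH : H.PosSemidef) (e : ℂ) {r : ℝ} (hr : r ≠ 0)
    (he : star e + e = r) : hsSq (fc hH.1 (pw e)) = trPow H r := by
  have h2 := ofReal_hsSq (fc hH.1 (pw e))
  rw [fc_pw_conjTranspose, fc_pw_mul, he, ← mpow_eq_fc_pw hH hr, ← ofReal_trPow hH.1] at h2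
  exact_mod_cast h2

/-- For Re e = -1/2 the Gram matrix of X H^e, H = X†X, is the support projection of H. Thus X H^e is
the partial isometry of the polar decomposition of X, up to an imaginary power of H. -/
lemma opNorm_mul_fc_pw_le_one (X : Matrix m n ℂ) (e : ℂ) (he : star e + 1 + e = 0) :
    opNorm (X * fc (isHermitian_conjTranspose_mul_self X) (pw e)) ≤ 1 := by
  have hP := posSemidef_conjTranspose_mul_self X
  have h : (X * fc (isHermitian_conjTranspose_mul_self X) (pw e))ᴴ *
      (X * fc (isHermitian_conjTranspose_mul_self X) (pw e)) = fc hP.1 (pw 0) := by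
    rw [conjTranspose_mul, fc_pw_conjTranspose, Matrix.mul_assoc,
      ← Matrix.mul_assoc Xᴴ, ← Matrix.mul_assoc, fc_pw_mul_self hP, fc_pw_mul, he]
  refine opNorm_le_one_of_idempotent ?_
  rw [h, fc_pw_mul, add_zero]

lemma opNorm_fc_pw_le_one {A : Matrix n n ℂ} (hA : A.PosDef) (e : ℂ) (he : star e + e = 0) :
    opNorm (fc hA.1 (pw e)) ≤ 1 := by
  refine opNorm_le_one_of_isometry ?_
  rw [fc_pw_conjTranspose, fc_pw_mul, he, fc_pw_zero hA]

/-- The zeroth power is the support projection of X†X, and X vanishes on its complement. -/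
lemma mul_fc_pw_zero (X : Matrix m n ℂ) :
    X * fc (isHermitian_conjTranspose_mul_self X) (pw 0) = X := by
  have hP := posSemidef_conjTranspose_mul_self X
  set Q := fc (isHermitian_conjTranspose_mul_self X) (pw 0) with hQ
  have h1 : Xᴴ * X * Q = Xᴴ * X := by
    conv_lhs => rw [← fc_pw_one hP]
    rw [hQ, fc_pw_mul, add_zero, fc_pw_one hP]
  have h2 : Qᴴ = Q := by rw [hQ, fc_pw_conjTranspose, star_zero]
  have h3 : (X * Q - X)ᴴ * (X * Q - X) = 0 := by
    rw [conjTranspose_sub, conjTranspose_mul, h2, Matrix.sub_mul, Matrix.mul_sub, Matrix.mul_sub]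
    simp only [Matrix.mul_assoc]
    rw [← Matrix.mul_assoc Xᴴ, h1]
    simp
  exact sub_eq_zero.mp (conjTranspose_mul_self_eq_zero.mp h3)

end TracePower

/-! ### The interpolation inequality -/

section Interpolation

variable {κ m n : Type*} [Fintype κ] [Fintype m] [Fintype n]
  [DecidableEq κ] [DecidableEq m] [DecidableEq n]

/-- `D ∈ S` is the trace preserving conditional expectation of `A` onto the star subalgebra `S`,
and both are positive definite. -/
structure IsCompression (S : StarSubalgebra ℂ (Matrix κ κ ℂ)) (A D : Matrix κ κ ℂ) : Prop where
  posDef_left : A.PosDef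
  posDef_right : D.PosDef
  mem : D ∈ S
  trace_eq : ∀ W ∈ S, trace (A * W) = trace (D * W)

variable {S : StarSubalgebra ℂ (Matrix κ κ ℂ)}

/-- Here Re e = 1/2. With V = D^(-e) W ∈ S, the compression property gives ‖A^(1/2) V‖₂² = tr(A VV†)
= tr(D VV†) = ‖D^(1/2) V‖₂². The remaining powers A^(e - 1/2) and D^(1/2 - e) are imaginary, hence
contractions. -/
lemma IsCompression.hsSq_le {A D W : Matrix κ κ ℂ} (h : IsCompression S A D) (hW : W ∈ S) {e : ℂ}
    (he : star e + e = 1) :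
    hsSq (fc h.posDef_left.1 (pw e) * fc h.posDef_right.1 (pw (-e)) * W) ≤ hsSq W := by
  have hA := h.posDef_left
  have hD := h.posDef_right
  set V := fc hD.1 (pw (-e)) * W with hV
  have hVS : V ∈ S := mul_mem (fc_mem _ h.mem _) hW
  have key : ∀ {B : Matrix κ κ ℂ} (hB : B.PosDef),
      (hsSq (fc hB.1 (pw (1 / 2)) * V) : ℂ) = trace (B * (V * Vᴴ)) := by
    intro B hB
    have hh : star (1 / 2 : ℂ) + 1 / 2 = 1 := by
      simp only [Complex.star_def, map_div₀, map_one, map_ofNat]; norm_num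
    rw [ofReal_hsSq, conjTranspose_mul, fc_pw_conjTranspose, Matrix.mul_assoc,
      ← Matrix.mul_assoc (fc _ _) (fc _ _), fc_pw_mul, hh, fc_pw_one hB.posSemidef,
      trace_mul_comm, Matrix.mul_assoc]
  have h1 : hsSq (fc hA.1 (pw (1 / 2)) * V) = hsSq (fc hD.1 (pw (1 / 2)) * V) := by
    have := (key hA).trans ((h.trace_eq _ (mul_mem hVS (star_mem hVS))).trans (key hD).symm)
    exact_mod_cast this
  have hre : star (e - 1 / 2) + (e - 1 / 2) = 0 := by
    simp only [Complex.star_def, map_sub, map_div₀, map_one, map_ofNat] at he ⊢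
    linear_combination he
  rw [Matrix.mul_assoc, ← hV]
  have h2 : fc hA.1 (pw e) = fc hA.1 (pw (e - 1 / 2)) * fc hA.1 (pw (1 / 2)) := by
    rw [fc_pw_mul, sub_add_cancel]
  rw [h2, Matrix.mul_assoc]
  refine (hsSq_mul_le _ _ (opNorm_fc_pw_le_one hA _ hre)).trans ?_
  rw [h1, hV, ← Matrix.mul_assoc, fc_pw_mul]
  refine hsSq_mul_le _ _ (opNorm_fc_pw_le_one hD _ ?_)
  rw [← neg_eq_zero, ← hre]
  simp only [star_add, star_sub, star_neg]
  ring_nf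

/-- The Hölder-dual `|X| ^ (p - 2) X†` of a matrix. -/
def dualMat (p : ℝ) (X : Matrix m n ℂ) : Matrix n m ℂ :=
  fc (isHermitian_conjTranspose_mul_self X) (pw ((p / 2 - 1 : ℝ) : ℂ)) * Xᴴ

lemma trace_mul_dualMat {p : ℝ} (hp : 1 ≤ p) (X : Matrix m n ℂ) :
    trace (X * dualMat p X) = trPow (Xᴴ * X) (p / 2) := by
  have hP := posSemidef_conjTranspose_mul_self X
  rw [ofReal_trPow hP.1, mpow_eq_fc_pw hP (by positivity), dualMat, trace_mul_comm,
    Matrix.mul_assoc, fc_pw_mul_self hP]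
  congr 3
  push_cast
  ring

lemma norm_trace_mul_mul_le {C : Matrix m n ℂ} (hC : opNorm C ≤ 1) (Y : Matrix n κ ℂ)
    (Y' : Matrix κ m ℂ) : ‖trace (C * (Y * Y'))‖ ≤ √(hsSq Y) * √(hsSq Y') := by
  rw [← Matrix.mul_assoc]
  refine (norm_trace_mul_le _ _).trans ?_
  gcongr
  exact hsSq_mul_le _ _ hC

/-- The interpolation inequality behind both the Hölder inequality and the estimate of
compressions, obtained from the three lines theorem. -/
theorem norm_trace_compression_le {A₁ D₁ A₂ D₂ Z : Matrix κ κ ℂ} (h₁ : IsCompression S A₁ D₁)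
    (h₂ : IsCompression S A₂ D₂) (hZ : Z ∈ S) {p : ℝ} (hp : 1 ≤ p) (X : Matrix m n ℂ)
    {w₁ : Matrix κ n ℂ} {w₂ : Matrix m κ ℂ} (hw₁ : opNorm w₁ ≤ 1) (hw₂ : opNorm w₂ ≤ 1) :
    ‖trace (mpow A₁ (1 / (2 * p)) * mpow D₁ (-(1 / (2 * p))) * Z *
        (mpow D₂ (-(1 / (2 * p))) * mpow A₂ (1 / (2 * p))) * (w₁ * dualMat p X * w₂))‖ ≤
      trPow (Xᴴ * X) (p / 2) ^ (1 - 1 / p) * trPow (Zᴴ * Z) (p / 2) ^ (1 / p) := by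
  have hp0 : 0 < p := by linarith
  have hA₁ := h₁.posDef_left
  have hD₁ := h₁.posDef_right
  have hA₂ := h₂.posDef_left
  have hD₂ := h₂.posDef_right
  have hHX := posSemidef_conjTranspose_mul_self X
  have hHZ := posSemidef_conjTranspose_mul_self Z
  have hp4 : p / 2 ≠ 0 := by positivity
  -- The affine exponents are chosen so that s = 1/p gives the trace to be estimated: a = 1/2p, d =
  -- -a, b = 0 and c = p/2 - 1. Moreover Re b = -1/2 on Re s = 0 and Re c = -1/2 on Re s = 1, which
  -- makes the Z-factor, respectively the X-factor, a partial isometry there.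
  set a : ℂ → ℂ := fun s => ((1 / 2 : ℝ) : ℂ) * s + ((0 : ℝ) : ℂ) with ha
  set d : ℂ → ℂ := fun s => ((-(1 / 2) : ℝ) : ℂ) * s + ((0 : ℝ) : ℂ) with hd
  set b : ℂ → ℂ := fun s => ((p / 2 : ℝ) : ℂ) * s + ((-(1 / 2) : ℝ) : ℂ) with hb
  set c : ℂ → ℂ := fun s => ((-(p / 2) : ℝ) : ℂ) * s + (((p - 1) / 2 : ℝ) : ℂ) with hc
  have hda : ∀ s, d s = -a s := fun s => by simp only [ha, hd]; push_cast; ring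
  let F : ℂ → ℂ := fun s => trace (fc hA₁.1 (pw (a s)) * fc hD₁.1 (pw (d s)) *
    (Z * fc hHZ.1 (pw (b s))) * (fc hD₂.1 (pw (d s)) * fc hA₂.1 (pw (a s))) *
    (w₁ * (fc hHX.1 (pw (c s)) * Xᴴ) * w₂))
  have hF : StripFn F := by
    refine StripMat.trace (StripMat.mul (StripMat.mul (StripMat.mul (StripMat.mul ?_ ?_)
      (StripMat.mul (StripMat.const _) ?_)) (StripMat.mul ?_ ?_))
      (StripMat.mul (StripMat.mul (StripMat.const _) (StripMat.mul ?_ (StripMat.const _)))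
      (StripMat.const _)))
    all_goals exact stripMat_fc_pw _ _ _
  have hstar : ∀ s : ℂ, (starRingEnd ℂ) s = 2 * (s.re : ℂ) - s := fun s => by
    have := Complex.add_conj s
    push_cast at this
    linear_combination this
  have star_a : ∀ s : ℂ, star (a s) + a s = s.re := fun s => by
    simp only [ha, Complex.star_def, map_add, map_mul, Complex.conj_ofReal, hstar s]; push_cast; ring
  have star_b : ∀ s : ℂ, star (b s) + 1 + b s = p * s.re := fun s => by
    simp only [hb, Complex.star_def, map_add, map_mul, Complex.conj_ofReal, hstar s]; push_cast; ring
  have star_c : ∀ s : ℂ, star (c s) + 1 + c s = p * (1 - s.re) := fun s => by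
    simp only [hc, Complex.star_def, map_add, map_mul, Complex.conj_ofReal, hstar s]; push_cast; ring
  have star_p : star ((p / 4 : ℝ) : ℂ) = ((p / 4 : ℝ) : ℂ) := by
    rw [Complex.star_def, Complex.conj_ofReal]
  have hsp : ∀ {H : Matrix κ κ ℂ} (hH : H.PosSemidef),
      hsSq (fc hH.1 (pw ((p / 4 : ℝ) : ℂ))) = trPow H (p / 2) := fun hH => by
    refine hsSq_fc_pw hH _ hp4 ?_
    rw [star_p]; push_cast; ring
  have hspX : hsSq (fc hHX.1 (pw ((p / 4 : ℝ) : ℂ))) = trPow (Xᴴ * X) (p / 2) := by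
    refine hsSq_fc_pw hHX _ hp4 ?_
    rw [star_p]; push_cast; ring
  -- On this line everything except the X-factor is a contraction. The X-factor is split into two
  -- matrices whose squared Hilbert–Schmidt norms both equal tr (X†X)^(p/2).
  have at0 : ∀ s : ℂ, s.re = 0 → ‖F s‖ ≤ trPow (Xᴴ * X) (p / 2) := by
    intro s hs
    have ea : star (a s) + a s = 0 := by rw [star_a, hs, Complex.ofReal_zero]
    have ed : star (d s) + d s = 0 := by rw [hda, star_neg, ← neg_add, ea, neg_zero]
    have e1 : opNorm (Z * fc hHZ.1 (pw (b s))) ≤ 1 :=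
      opNorm_mul_fc_pw_le_one Z _ (by rw [star_b, hs]; simp)
    set C := fc hA₁.1 (pw (a s)) * fc hD₁.1 (pw (d s)) *
      (Z * fc hHZ.1 (pw (b s))) * (fc hD₂.1 (pw (d s)) * fc hA₂.1 (pw (a s))) with hCdef
    have hC : opNorm C ≤ 1 :=
      opNorm_mul_le_one (opNorm_mul_le_one (opNorm_mul_le_one (opNorm_fc_pw_le_one hA₁ _ ea)
        (opNorm_fc_pw_le_one hD₁ _ ed)) e1)
        (opNorm_mul_le_one (opNorm_fc_pw_le_one hD₂ _ ed) (opNorm_fc_pw_le_one hA₂ _ ea))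
    have h3 : fc hHX.1 (pw (c s)) * Xᴴ = fc hHX.1 (pw ((p / 4 : ℝ) : ℂ)) *
        (X * fc hHX.1 (pw (star (c s - ((p / 4 : ℝ) : ℂ)))))ᴴ := by
      rw [conjTranspose_mul, fc_pw_conjTranspose, star_star, ← Matrix.mul_assoc, fc_pw_mul,
        add_sub_cancel]
    have h4 : F s = trace ((w₂ * C * w₁) * (fc hHX.1 (pw ((p / 4 : ℝ) : ℂ)) *
        (X * fc hHX.1 (pw (star (c s - ((p / 4 : ℝ) : ℂ)))))ᴴ)) := by
      rw [← h3]
      simp only [F, ← hCdef]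
      rw [← Matrix.mul_assoc, trace_mul_comm]
      simp only [Matrix.mul_assoc]
    rw [h4]
    refine (norm_trace_mul_mul_le (opNorm_mul_le_one (opNorm_mul_le_one hw₂ hC) hw₁) _ _).trans ?_
    rw [hsSq_conjTranspose, hsSq_mul_fc_pw X _ hp4, hspX, Real.mul_self_sqrt (trPow_nonneg hHX _)]
    rw [star_star, star_sub, star_p]
    have := star_c s
    rw [hs] at this
    push_cast at this ⊢
    linear_combination this
  -- Now the X-factor is a contraction and the Z-factor is split as Z₁ Z₂ inside S, so that
  -- `IsCompression.hsSq_le` absorbs the powers of A₁, D₁ on the left and of D₂, A₂ on the right.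
  have at1 : ∀ s : ℂ, s.re = 1 → ‖F s‖ ≤ trPow (Zᴴ * Z) (p / 2) := by
    intro s hs
    have ea : star (a s) + a s = 1 := by rw [star_a, hs, Complex.ofReal_one]
    have eY : opNorm (fc hHX.1 (pw (c s)) * Xᴴ) ≤ 1 := by
      rw [← opNorm_conjTranspose, conjTranspose_mul, conjTranspose_conjTranspose,
        fc_pw_conjTranspose]
      refine opNorm_mul_fc_pw_le_one X _ ?_
      have := star_c s
      rw [hs] at this
      rw [star_star]
      push_cast at this
      linear_combination this
    set G := w₁ * (fc hHX.1 (pw (c s)) * Xᴴ) * w₂ with hG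
    have eG : opNorm G ≤ 1 := opNorm_mul_le_one (opNorm_mul_le_one hw₁ eY) hw₂
    set Z₁ := Z * fc hHZ.1 (pw (b s - ((p / 4 : ℝ) : ℂ))) with hZ₁
    set Z₂ := fc hHZ.1 (pw ((p / 4 : ℝ) : ℂ)) with hZ₂
    have hHZS : Zᴴ * Z ∈ S := mul_mem (star_mem hZ) hZ
    have hZ₁S : Z₁ ∈ S := mul_mem hZ (fc_mem _ hHZS _)
    have hZ₂S : Z₂ᴴ ∈ S := star_mem (fc_mem _ hHZS _)
    have h3 : Z * fc hHZ.1 (pw (b s)) = Z₁ * Z₂ := by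
      rw [hZ₁, hZ₂, Matrix.mul_assoc, fc_pw_mul, sub_add_cancel]
    have h4 : F s = trace (G * ((fc hA₁.1 (pw (a s)) * fc hD₁.1 (pw (d s)) * Z₁) *
        (fc hA₂.1 (pw (star (a s))) * fc hD₂.1 (pw (star (d s))) * Z₂ᴴ)ᴴ)) := by
      simp only [F, ← hG, h3]
      rw [trace_mul_comm]
      simp only [conjTranspose_mul, fc_pw_conjTranspose, star_star, conjTranspose_conjTranspose,
        Matrix.mul_assoc]
    rw [h4]
    refine (norm_trace_mul_mul_le eG _ _).trans ?_
    rw [hsSq_conjTranspose, ← Real.mul_self_sqrt (trPow_nonneg hHZ (p / 2))]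
    have k1 : hsSq Z₁ = trPow (Zᴴ * Z) (p / 2) := by
      refine hsSq_mul_fc_pw Z _ hp4 ?_
      rw [star_sub, star_p]
      have := star_b s
      rw [hs] at this
      push_cast at this ⊢
      linear_combination this
    have k2 : hsSq Z₂ᴴ = trPow (Zᴴ * Z) (p / 2) := by
      rw [hsSq_conjTranspose, hZ₂, hsp hHZ]
    gcongr
    · rw [← k1, hda]
      exact h₁.hsSq_le hZ₁S ea
    · rw [← k2, hda, star_neg]
      exact h₂.hsSq_le hZ₂S (by rw [star_star, add_comm, ea])
  have hmain := hF.norm_le at0 at1 (r := 1 / p) (by positivity)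
    (by rw [div_le_one hp0]; exact hp)
  have hpC : (p : ℂ) ≠ 0 := by exact_mod_cast hp0.ne'
  have va : a ((1 / p : ℝ) : ℂ) = ((1 / (2 * p) : ℝ) : ℂ) := by
    simp only [ha]; push_cast; field_simp; ring
  have vd : d ((1 / p : ℝ) : ℂ) = ((-(1 / (2 * p)) : ℝ) : ℂ) := by
    rw [hda, va]; push_cast; ring
  have vb : b ((1 / p : ℝ) : ℂ) = 0 := by
    simp only [hb]; push_cast; field_simp; ring
  have vc : c ((1 / p : ℝ) : ℂ) = ((p / 2 - 1 : ℝ) : ℂ) := by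
    simp only [hc]; push_cast; field_simp; ring
  have hFv : F ((1 / p : ℝ) : ℂ) = trace (mpow A₁ (1 / (2 * p)) * mpow D₁ (-(1 / (2 * p))) * Z *
        (mpow D₂ (-(1 / (2 * p))) * mpow A₂ (1 / (2 * p))) * (w₁ * dualMat p X * w₂)) := by
    simp only [F, va, vd, vb, vc]
    rw [mul_fc_pw_zero Z, mpow_eq_fc_pw_of_posDef hA₁, mpow_eq_fc_pw_of_posDef hD₁,
      mpow_eq_fc_pw_of_posDef hA₂, mpow_eq_fc_pw_of_posDef hD₂]
    rfl
  rw [← hFv]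
  exact hmain

end Interpolation

/-! ### Schatten norms -/

section Schatten

variable {κ m n : Type*} [Fintype κ] [Fintype m] [Fintype n]
  [DecidableEq κ] [DecidableEq m] [DecidableEq n]

/-- The Schatten `p`-norm of a rectangular matrix. -/
def schatten (p : ℝ) (X : Matrix m n ℂ) : ℝ := trPow (Xᴴ * X) (p / 2) ^ (1 / p)

lemma schatten_nonneg (p : ℝ) (X : Matrix m n ℂ) : 0 ≤ schatten p X :=
  Real.rpow_nonneg (trPow_nonneg (posSemidef_conjTranspose_mul_self X) _) _

lemma schatten_rpow {p : ℝ} (hp : 1 ≤ p) (X : Matrix m n ℂ) :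
    schatten p X ^ p = trPow (Xᴴ * X) (p / 2) := by
  rw [schatten, ← Real.rpow_mul (trPow_nonneg (posSemidef_conjTranspose_mul_self X) _),
    one_div_mul_cancel (by positivity), Real.rpow_one]

lemma schatten_eq_zero {p : ℝ} (hp : 1 ≤ p) (X : Matrix m n ℂ) : schatten p X = 0 ↔ X = 0 := by
  have h := posSemidef_conjTranspose_mul_self X
  rw [schatten, Real.rpow_eq_zero (trPow_nonneg h _) (by positivity),
    trPow_eq_zero h (by positivity), conjTranspose_mul_self_eq_zero]

lemma schatten_zero {p : ℝ} (hp : 1 ≤ p) : schatten p (0 : Matrix m n ℂ) = 0 :=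
  (schatten_eq_zero hp 0).mpr rfl

lemma schatten_smul {p : ℝ} (hp : 1 ≤ p) (c : ℂ) (X : Matrix m n ℂ) :
    schatten p (c • X) = ‖c‖ * schatten p X := by
  have h := posSemidef_conjTranspose_mul_self X
  have h1 : (c • X)ᴴ * (c • X) = ((‖c‖ ^ 2 : ℝ) : ℂ) • (Xᴴ * X) := by
    rw [conjTranspose_smul, Matrix.smul_mul, Matrix.mul_smul, smul_smul]
    congr 1
    rw [Complex.star_def, Complex.conj_mul']
    push_cast
    rfl
  rw [schatten, schatten, h1, trPow, mpow_smul h (by positivity), trace_smul, smul_eq_mul,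
    Complex.re_ofReal_mul, ← trPow, Real.mul_rpow (by positivity) (trPow_nonneg h _),
    ← Real.rpow_natCast, ← Real.rpow_mul (norm_nonneg c), ← Real.rpow_mul (norm_nonneg c)]
  congr 1
  rw [show (((2 : ℕ) : ℝ) * (p / 2)) * (1 / p) = 1 by push_cast; field_simp, Real.rpow_one]

/-- The final step of each duality argument: ‖X‖_p^p ≤ ‖X‖_p^(p-1) C, and the common factor is
cancelled unless X = 0. -/
lemma schatten_le_of_trPow_le {p : ℝ} (hp : 1 ≤ p) {X : Matrix m n ℂ} {C : ℝ} (hC : 0 ≤ C)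
    (h : trPow (Xᴴ * X) (p / 2) ≤ trPow (Xᴴ * X) (p / 2) ^ (1 - 1 / p) * C) :
    schatten p X ≤ C := by
  have h0 := trPow_nonneg (posSemidef_conjTranspose_mul_self X) (p / 2)
  unfold schatten
  rcases h0.eq_or_lt with h1 | h1
  · rw [← h1, Real.zero_rpow (by positivity)]
    exact hC
  · have h2 : trPow (Xᴴ * X) (p / 2) = trPow (Xᴴ * X) (p / 2) ^ (1 - 1 / p) *
        trPow (Xᴴ * X) (p / 2) ^ (1 / p) := by
      rw [← Real.rpow_add h1, sub_add_cancel, Real.rpow_one]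
    nth_rewrite 1 [h2] at h
    exact le_of_mul_le_mul_left h (by positivity)

lemma mpow_one_left (r : ℝ) : mpow (1 : Matrix κ κ ℂ) r = 1 := by
  have h := isHermitian_one (n := κ) (α := ℂ)
  have h1 : ∀ i, h.eigenvalues i = 1 := fun i => by
    have : h.eigenvalues i ∈ spectrum ℝ (1 : Matrix κ κ ℂ) := h.eigenvalues_mem_spectrum_real i
    rcases isEmpty_or_nonempty κ with h' | h'
    · exact (h'.false i).elim
    · rwa [spectrum.one_eq, Set.mem_singleton_iff] at this
  rw [mpow_eq_fc h]
  refine Eq.trans (fc_congr h fun i => ?_) (fc_one h)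
  rw [h1, Real.one_rpow, Complex.ofReal_one]

/-- The trivial compression, for which the interpolation inequality becomes Hölder's inequality. -/
lemma isCompression_one : IsCompression ⊤ (1 : Matrix κ κ ℂ) 1 :=
  ⟨PosDef.one, PosDef.one, StarSubalgebra.mem_top, fun _ _ => rfl⟩

/-- Hölder's inequality in the form needed for duality. -/
lemma norm_trace_mul_dualMat_le {p : ℝ} (hp : 1 ≤ p) (Z : Matrix κ κ ℂ) (X : Matrix m n ℂ)
    {w₁ : Matrix κ n ℂ} {w₂ : Matrix m κ ℂ} (hw₁ : opNorm w₁ ≤ 1) (hw₂ : opNorm w₂ ≤ 1) :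
    ‖trace (Z * (w₁ * dualMat p X * w₂))‖ ≤
      trPow (Xᴴ * X) (p / 2) ^ (1 - 1 / p) * schatten p Z := by
  have := norm_trace_compression_le isCompression_one isCompression_one
    (StarSubalgebra.mem_top (x := Z)) hp X hw₁ hw₂
  simp only [mpow_one_left, Matrix.one_mul, Matrix.mul_one] at this
  exact this

lemma norm_trace_dualMat {p : ℝ} (hp : 1 ≤ p) (X : Matrix m n ℂ) :
    ‖trace (X * dualMat p X)‖ = trPow (Xᴴ * X) (p / 2) := by
  rw [trace_mul_dualMat hp, Complex.norm_real, Real.norm_of_nonneg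
    (trPow_nonneg (posSemidef_conjTranspose_mul_self X) _)]

/-- Duality: pairing vZw with its Hölder dual and cycling the trace puts both contractions next to
the dual matrix, where Hölder's inequality allows them. -/
lemma schatten_mul_mul_le {p : ℝ} (hp : 1 ≤ p) (Z : Matrix κ κ ℂ)
    {v : Matrix m κ ℂ} {w : Matrix κ n ℂ} (hv : opNorm v ≤ 1) (hw : opNorm w ≤ 1) :
    schatten p (v * Z * w) ≤ schatten p Z := by
  refine schatten_le_of_trPow_le hp (schatten_nonneg _ _) ?_
  refine le_trans (le_of_eq ?_) (norm_trace_mul_dualMat_le hp Z (v * Z * w) hw hv)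
  rw [← norm_trace_dualMat hp, Matrix.mul_assoc v, Matrix.mul_assoc v, trace_mul_comm]
  simp only [Matrix.mul_assoc]

lemma schatten_add_le {p : ℝ} (hp : 1 ≤ p) (X Y : Matrix κ κ ℂ) :
    schatten p (X + Y) ≤ schatten p X + schatten p Y := by
  refine schatten_le_of_trPow_le hp (add_nonneg (schatten_nonneg _ _) (schatten_nonneg _ _)) ?_
  have h1 := norm_trace_mul_dualMat_le hp X (X + Y) (opNorm_one_le (n := κ)) opNorm_one_le
  have h2 := norm_trace_mul_dualMat_le hp Y (X + Y) (opNorm_one_le (n := κ)) opNorm_one_le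
  rw [Matrix.one_mul, Matrix.mul_one] at h1 h2
  rw [mul_add (_ ^ _)]
  refine le_trans (le_of_eq ?_) ((norm_add_le _ _).trans (add_le_add h1 h2))
  rw [← norm_trace_dualMat hp, Matrix.add_mul, trace_add]

/-- The interpolation inequality paired with the Hölder dual of the compressed matrix itself. -/
lemma schatten_compression_le {S : StarSubalgebra ℂ (Matrix κ κ ℂ)} {A₁ D₁ A₂ D₂ Z : Matrix κ κ ℂ}
    (h₁ : IsCompression S A₁ D₁) (h₂ : IsCompression S A₂ D₂) (hZ : Z ∈ S) {p : ℝ} (hp : 1 ≤ p) :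
    schatten p (mpow A₁ (1 / (2 * p)) * mpow D₁ (-(1 / (2 * p))) * Z *
      (mpow D₂ (-(1 / (2 * p))) * mpow A₂ (1 / (2 * p)))) ≤ schatten p Z := by
  refine schatten_le_of_trPow_le hp (schatten_nonneg _ _) ?_
  have h := norm_trace_compression_le h₁ h₂ hZ hp (mpow A₁ (1 / (2 * p)) *
    mpow D₁ (-(1 / (2 * p))) * Z * (mpow D₂ (-(1 / (2 * p))) * mpow A₂ (1 / (2 * p))))
    (opNorm_one_le (n := κ)) opNorm_one_le
  rw [Matrix.one_mul, Matrix.mul_one, norm_trace_dualMat hp] at h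
  exact h

lemma exists_contraction_smul (A : Matrix m n ℂ) :
    ∃ B : Matrix m n ℂ, opNorm B ≤ 1 ∧ A = (opNorm A : ℂ) • B := by
  rcases eq_or_ne (opNorm A) 0 with h | h
  · exact ⟨0, by simp [opNorm_zero], by rw [opNorm_eq_zero.mp h, smul_zero]⟩
  · refine ⟨(opNorm A : ℂ)⁻¹ • A, ?_, ?_⟩
    · rw [opNorm_smul, norm_inv, Complex.norm_real, Real.norm_of_nonneg (opNorm_nonneg A),
        inv_mul_cancel₀ h]
    · rw [smul_smul, mul_inv_cancel₀ (by exact_mod_cast h), one_smul]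

lemma schatten_mul_mul_le_opNorm {p : ℝ} (hp : 1 ≤ p) (v : Matrix m κ ℂ) (Z : Matrix κ κ ℂ)
    (w : Matrix κ n ℂ) : schatten p (v * Z * w) ≤ opNorm v * schatten p Z * opNorm w := by
  obtain ⟨v', hv', hv⟩ := exists_contraction_smul v
  obtain ⟨w', hw', hw⟩ := exists_contraction_smul w
  have h1 : v * Z * w = ((opNorm v * opNorm w : ℝ) : ℂ) • (v' * Z * w') := by
    conv_lhs => rw [hv, hw]
    simp only [Matrix.smul_mul, Matrix.mul_smul, smul_smul]
    push_cast
    rw [mul_comm]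
  rw [h1, schatten_smul hp, Complex.norm_real, Real.norm_of_nonneg
    (mul_nonneg (opNorm_nonneg v) (opNorm_nonneg w))]
  calc opNorm v * opNorm w * schatten p (v' * Z * w')
      ≤ opNorm v * opNorm w * schatten p Z :=
        mul_le_mul_of_nonneg_left (schatten_mul_mul_le hp Z hv' hw')
          (mul_nonneg (opNorm_nonneg v) (opNorm_nonneg w))
    _ = _ := by ring

lemma mpow_conjTranspose_mul_self {H : Matrix κ κ ℂ} (hH : H.PosSemidef) (r : ℝ) :
    mpow (Hᴴ * H) (r / 2) = mpow H r := by
  have h : Hᴴ * H = mpow H 2 := by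
    have h1 := fc_pw_mul hH.1 1 1
    rw [fc_pw_one hH] at h1
    rw [hH.1.eq, h1, mpow_eq_fc_pw hH two_ne_zero]
    congr 2
    norm_num
  rw [h, mpow_mpow hH]
  congr 1
  ring

lemma schatten_of_posSemidef {H : Matrix κ κ ℂ} (hH : H.PosSemidef) (p : ℝ) :
    schatten p H = trPow H p ^ (1 / p) := by
  rw [schatten, trPow, mpow_conjTranspose_mul_self hH, trPow]

/-- Reduces 2p-norms to p-norms of Gram matrices, to which the two-sided ideal property and the
triangle inequality apply. -/
lemma schatten_two_mul_sq {p : ℝ} (hp : 1 ≤ p) (a : Matrix m n ℂ) :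
    schatten (2 * p) a ^ 2 = schatten p (aᴴ * a) := by
  have h := posSemidef_conjTranspose_mul_self a
  rw [schatten_of_posSemidef h, schatten, ← Real.rpow_mul_natCast (trPow_nonneg h _),
    mul_div_cancel_left₀ p two_ne_zero]
  congr 1
  push_cast
  field_simp

/-- Since a intertwines aa† and a†a, one has (aa†)^(r-1) a = a (a†a)^(r-1), and cyclicity of the
trace finishes. The powers `pw` vanish at 0, so r < 1 and singular a cause no difficulty. -/
lemma trPow_mul_conjTranspose_self (a : Matrix m n ℂ) {r : ℝ} (hr : 0 < r) :
    trPow (a * aᴴ) r = trPow (aᴴ * a) r := by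
  have h1 := posSemidef_self_mul_conjTranspose a
  have h2 := posSemidef_conjTranspose_mul_self a
  have h3 : fc h1.1 (pw (r - 1)) * a = a * fc h2.1 (pw (r - 1)) :=
    fc_intertwine h1.1 h2.1 (Matrix.mul_assoc _ _ _) _
  have h4 : mpow (a * aᴴ) r = fc h1.1 (pw (r - 1)) * (a * aᴴ) := by
    rw [fc_pw_mul_self h1, sub_add_cancel, mpow_eq_fc_pw h1 hr.ne']
  have h5 : mpow (aᴴ * a) r = fc h2.1 (pw (r - 1)) * (aᴴ * a) := by
    rw [fc_pw_mul_self h2, sub_add_cancel, mpow_eq_fc_pw h2 hr.ne']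
  rw [trPow, trPow, h4, h5, ← Matrix.mul_assoc, h3, Matrix.mul_assoc, trace_mul_comm,
    Matrix.mul_assoc]

lemma schatten_conjTranspose {p : ℝ} (hp : 1 ≤ p) (a : Matrix m n ℂ) :
    schatten p aᴴ = schatten p a := by
  rw [schatten, schatten, conjTranspose_conjTranspose, trPow_mul_conjTranspose_self a (by positivity)]

lemma schatten_two_mul_mul_le {p : ℝ} (hp : 1 ≤ p) (a : Matrix κ κ ℂ) (w : Matrix κ n ℂ) :
    schatten (2 * p) (a * w) ≤ schatten (2 * p) a * opNorm w := by
  refine (sq_le_sq₀ (schatten_nonneg _ _)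
    (mul_nonneg (schatten_nonneg _ _) (opNorm_nonneg _))).mp ?_
  rw [schatten_two_mul_sq hp, mul_pow, schatten_two_mul_sq hp]
  have := schatten_mul_mul_le_opNorm hp wᴴ (aᴴ * a) w
  rw [opNorm_conjTranspose] at this
  rw [conjTranspose_mul, Matrix.mul_assoc, ← Matrix.mul_assoc aᴴ, ← Matrix.mul_assoc wᴴ]
  linarith

end Schatten

/-! ### Bounds for the amalgamated norm -/

section AmalgamatedBound

variable {κ m n : Type*} [Fintype κ] [Fintype m] [Fintype n]
  [DecidableEq κ] [DecidableEq m] [DecidableEq n]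

/-- The bound `‖P^(1/2p) z Q^(1/2p)‖_p ≤ C (tr P)^(1/2p) (tr Q)^(1/2p)` for positive definite
`P, Q ∈ S`. -/
def HasBound (S : StarSubalgebra ℂ (Matrix κ κ ℂ)) (p : ℝ) (z : Matrix κ κ ℂ) (C : ℝ) : Prop :=
  ∀ P ∈ S, ∀ Q ∈ S, P.PosDef → Q.PosDef →
    schatten p (mpow P (1 / (2 * p)) * z * mpow Q (1 / (2 * p))) ≤
      C * (trPow P 1 ^ (1 / (2 * p)) * trPow Q 1 ^ (1 / (2 * p)))

variable {S : StarSubalgebra ℂ (Matrix κ κ ℂ)}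

/-- Polar decomposition up to `ε`, inside the algebra. -/
lemma exists_eq_contraction_mul_mpow {p : ℝ} (hp : 1 ≤ p) {a : Matrix m κ ℂ} (ha : aᴴ * a ∈ S)
    {ε : ℝ} (hε : 0 < ε) : ∃ P ∈ S, P.PosDef ∧ ∃ k : Matrix m κ ℂ, opNorm k ≤ 1 ∧
      a = k * mpow P (1 / (2 * p)) ∧ trPow P 1 ^ (1 / (2 * p)) ≤
        √(schatten (2 * p) a ^ 2 + ε * schatten p (1 : Matrix κ κ ℂ)) := by
  have hp0 : 0 < p := by linarith
  have hH := posSemidef_conjTranspose_mul_self a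
  have hε1 : ((ε : ℂ) • (1 : Matrix κ κ ℂ)).PosDef := PosDef.one.smul (by exact_mod_cast hε)
  -- The shift by ε makes c invertible. The witnesses are P = c^p, so that P^(1/2p) = c^(1/2), and k
  -- = a c^(-1/2), for which 1 - k†k = c^(-1/2) (ε · 1) c^(-1/2) ≥ 0.
  set c := aᴴ * a + (ε : ℂ) • (1 : Matrix κ κ ℂ) with hc
  have hcP : c.PosDef := PosDef.posSemidef_add hH hε1
  have hcS : c ∈ S := add_mem ha (S.smul_mem (one_mem S) _)
  refine ⟨mpow c p, mpow_mem hcP.1 hcS p, posDef_mpow hcP p, a * mpow c (-(1 / 2)), ?_, ?_, ?_⟩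
  · refine opNorm_le_of_posSemidef zero_le_one ?_
    have h1 : (((1 ^ 2 : ℝ) : ℂ) • (1 : Matrix κ κ ℂ) - (a * mpow c (-(1 / 2)))ᴴ *
        (a * mpow c (-(1 / 2)))) = (mpow c (-(1 / 2)))ᴴ * ((ε : ℂ) • (1 : Matrix κ κ ℂ)) *
          mpow c (-(1 / 2)) := by
      have h2 : (ε : ℂ) • (1 : Matrix κ κ ℂ) = c - aᴴ * a := by rw [hc, add_sub_cancel_left]
      have h3 : (mpow c (-(1 / 2)))ᴴ * c * mpow c (-(1 / 2)) = 1 := by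
        conv_lhs => rw [(isHermitian_mpow c _).eq]
        conv_lhs => enter [1, 2]; rw [← mpow_one hcP.1]
        rw [mpow_mul_mpow hcP, mpow_mul_mpow hcP, ← mpow_zero c hcP.1]
        norm_num
      rw [h2, Matrix.mul_sub, Matrix.sub_mul, h3, conjTranspose_mul]
      simp [Matrix.mul_assoc]
    rw [h1]
    exact hε1.posSemidef.conjTranspose_mul_mul_same _
  · rw [mpow_mpow hcP.posSemidef, Matrix.mul_assoc, mpow_mul_mpow hcP,
      show -(1 / 2) + p * (1 / (2 * p)) = 0 by field_simp; ring, mpow_zero c hcP.1, Matrix.mul_one]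
  · have h1 : trPow (mpow c p) 1 ^ (1 / (2 * p)) = √(schatten p c) := by
      rw [trPow, mpow_one (isHermitian_mpow c p), ← trPow, schatten_of_posSemidef hcP.posSemidef,
        Real.sqrt_eq_rpow, ← Real.rpow_mul (trPow_nonneg hcP.posSemidef _)]
      congr 1
      field_simp
    rw [h1]
    apply Real.sqrt_le_sqrt
    refine (schatten_add_le hp _ _).trans ?_
    rw [schatten_two_mul_sq hp, schatten_smul hp, Complex.norm_real, Real.norm_of_nonneg hε.le]

/-- A bound for positive definite elements of `S` extends to all rectangular factors `a`, `b` with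
`a† a ∈ S` and `b b† ∈ S`. -/
lemma HasBound.schatten_le {p : ℝ} (hp : 1 ≤ p) {z : Matrix κ κ ℂ} {C : ℝ}
    (h : HasBound S p z C) (hC : 0 ≤ C) {a : Matrix m κ ℂ} {b : Matrix κ n ℂ} (ha : aᴴ * a ∈ S)
    (hb : b * bᴴ ∈ S) :
    schatten p (a * z * b) ≤ C * (schatten (2 * p) a * schatten (2 * p) b) := by
  have h2p : 1 ≤ 2 * p := by linarith
  have key : ∀ ε : ℝ, 0 < ε → schatten p (a * z * b) ≤
      C * (√(schatten (2 * p) a ^ 2 + ε * schatten p (1 : Matrix κ κ ℂ)) *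
        √(schatten (2 * p) b ^ 2 + ε * schatten p (1 : Matrix κ κ ℂ))) := by
    intro ε hε
    obtain ⟨P, hPS, hP, k, hk, hak, hPle⟩ := exists_eq_contraction_mul_mpow hp ha hε
    obtain ⟨Q, hQS, hQ, l, hl, hbl, hQle⟩ := exists_eq_contraction_mul_mpow hp (a := bᴴ)
      (by rwa [conjTranspose_conjTranspose]) hε
    rw [schatten_conjTranspose h2p] at hQle
    have hb' : b = mpow Q (1 / (2 * p)) * lᴴ := by
      rw [← conjTranspose_conjTranspose b, hbl, conjTranspose_mul, (isHermitian_mpow Q _).eq]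
    have h1 : a * z * b = k * (mpow P (1 / (2 * p)) * z * mpow Q (1 / (2 * p))) * lᴴ := by
      conv_lhs => rw [hak, hb']
      simp only [Matrix.mul_assoc]
    rw [h1]
    refine (schatten_mul_mul_le hp _ hk (by rwa [opNorm_conjTranspose])).trans ?_
    refine (h P hPS Q hQS hP hQ).trans ?_
    have := Real.rpow_nonneg (trPow_nonneg hQ.posSemidef 1) (1 / (2 * p))
    gcongr
  -- The factors a and b may be singular or rectangular, so the sharp constant is reached only in
  -- the limit ε → 0.
  have lim : Filter.Tendsto (fun ε : ℝ => C * (√(schatten (2 * p) a ^ 2 + ε *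
      schatten p (1 : Matrix κ κ ℂ)) * √(schatten (2 * p) b ^ 2 + ε *
        schatten p (1 : Matrix κ κ ℂ)))) (nhdsWithin 0 (Set.Ioi 0))
      (nhds (C * (√(schatten (2 * p) a ^ 2 + 0 * schatten p (1 : Matrix κ κ ℂ)) *
        √(schatten (2 * p) b ^ 2 + 0 * schatten p (1 : Matrix κ κ ℂ))))) := by
    refine tendsto_nhdsWithin_of_tendsto_nhds (Continuous.tendsto ?_ 0)
    fun_prop
  rw [zero_mul, add_zero, add_zero, Real.sqrt_sq (schatten_nonneg _ _),
    Real.sqrt_sq (schatten_nonneg _ _)] at lim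
  exact ge_of_tendsto lim (Filter.eventually_of_mem self_mem_nhdsWithin fun ε hε => key ε hε)

/-- It suffices to insert a = P^(1/2p), whose 2p-norm is (tr P)^(1/2p). -/
lemma hasBound_of_schatten_le {p : ℝ} (hp : 1 ≤ p) {z : Matrix κ κ ℂ} {C : ℝ}
    (h : ∀ a ∈ S, ∀ b ∈ S, schatten p (a * z * b) ≤ C * (schatten (2 * p) a * schatten (2 * p) b)) :
    HasBound S p z C := by
  have hp0 : 0 < p := by linarith
  have key : ∀ {P : Matrix κ κ ℂ}, P.PosDef →
      schatten (2 * p) (mpow P (1 / (2 * p))) = trPow P 1 ^ (1 / (2 * p)) := by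
    intro P hP
    rw [schatten_of_posSemidef (posSemidef_mpow hP.posSemidef _), trPow,
      mpow_mpow hP.posSemidef, one_div_mul_cancel (by positivity), trPow]
  intro P hPS Q hQS hP hQ
  have := h _ (mpow_mem hP.1 hPS (1 / (2 * p))) _ (mpow_mem hQ.1 hQS (1 / (2 * p)))
  rwa [key hP, key hQ] at this

end AmalgamatedBound

/-! ### Orthogonal decompositions -/

section Decomposition

variable {κ κ₁ κ₂ : Type*} [Fintype κ] [Fintype κ₁] [Fintype κ₂]
  [DecidableEq κ] [DecidableEq κ₁] [DecidableEq κ₂]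

/-- Isometries `J₁`, `J₂` which identify `ℂ^κ` with the orthogonal sum of `ℂ^κ₁` and `ℂ^κ₂`. -/
structure IsDecomposition (J₁ : Matrix κ κ₁ ℂ) (J₂ : Matrix κ κ₂ ℂ) : Prop where
  left : J₁ᴴ * J₁ = 1
  right : J₂ᴴ * J₂ = 1
  orth : J₁ᴴ * J₂ = 0
  add : J₁ * J₁ᴴ + J₂ * J₂ᴴ = 1

variable {J₁ : Matrix κ κ₁ ℂ} {J₂ : Matrix κ κ₂ ℂ}

lemma IsDecomposition.orth' (h : IsDecomposition J₁ J₂) : J₂ᴴ * J₁ = 0 := by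
  have := congrArg conjTranspose h.orth
  simpa using this

/-- The block diagonal matrix with respect to a decomposition. -/
def diagSum (J₁ : Matrix κ κ₁ ℂ) (J₂ : Matrix κ κ₂ ℂ) (x : Matrix κ₁ κ₁ ℂ) (y : Matrix κ₂ κ₂ ℂ) :
    Matrix κ κ ℂ := J₁ * x * J₁ᴴ + J₂ * y * J₂ᴴ

lemma IsDecomposition.diagSum_mul_left (h : IsDecomposition J₁ J₂) (x : Matrix κ₁ κ₁ ℂ)
    (y : Matrix κ₂ κ₂ ℂ) : diagSum J₁ J₂ x y * J₁ = J₁ * x := by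
  rw [diagSum, Matrix.add_mul, Matrix.mul_assoc, h.left, Matrix.mul_assoc (J₂ * y), h.orth']
  simp

lemma IsDecomposition.diagSum_mul_right (h : IsDecomposition J₁ J₂) (x : Matrix κ₁ κ₁ ℂ)
    (y : Matrix κ₂ κ₂ ℂ) : diagSum J₁ J₂ x y * J₂ = J₂ * y := by
  rw [diagSum, Matrix.add_mul, Matrix.mul_assoc, h.orth, Matrix.mul_assoc (J₂ * y), h.right]
  simp

lemma conjTranspose_diagSum (x : Matrix κ₁ κ₁ ℂ) (y : Matrix κ₂ κ₂ ℂ) :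
    (diagSum J₁ J₂ x y)ᴴ = diagSum J₁ J₂ xᴴ yᴴ := by
  simp [diagSum, Matrix.mul_assoc]

lemma IsDecomposition.eq_diagSum (h : IsDecomposition J₁ J₂) {X : Matrix κ κ ℂ}
    {x : Matrix κ₁ κ₁ ℂ} {y : Matrix κ₂ κ₂ ℂ} (h1 : X * J₁ = J₁ * x) (h2 : X * J₂ = J₂ * y) :
    X = diagSum J₁ J₂ x y := by
  rw [diagSum, ← h1, ← h2, Matrix.mul_assoc, Matrix.mul_assoc, ← Matrix.mul_add, h.add,
    Matrix.mul_one]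

lemma IsDecomposition.diagSum_mul_diagSum (h : IsDecomposition J₁ J₂) (x x' : Matrix κ₁ κ₁ ℂ)
    (y y' : Matrix κ₂ κ₂ ℂ) :
    diagSum J₁ J₂ x y * diagSum J₁ J₂ x' y' = diagSum J₁ J₂ (x * x') (y * y') := by
  refine h.eq_diagSum ?_ ?_
  · rw [Matrix.mul_assoc, h.diagSum_mul_left, ← Matrix.mul_assoc, h.diagSum_mul_left,
      Matrix.mul_assoc]
  · rw [Matrix.mul_assoc, h.diagSum_mul_right, ← Matrix.mul_assoc, h.diagSum_mul_right,
      Matrix.mul_assoc]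

lemma IsDecomposition.diagSum_one (h : IsDecomposition J₁ J₂) : diagSum J₁ J₂ 1 1 = 1 := by
  simp [diagSum, h.add]

lemma IsDecomposition.trace_diagSum (h : IsDecomposition J₁ J₂) (x : Matrix κ₁ κ₁ ℂ)
    (y : Matrix κ₂ κ₂ ℂ) : trace (diagSum J₁ J₂ x y) = trace x + trace y := by
  rw [diagSum, trace_add, trace_mul_comm, ← Matrix.mul_assoc, h.left, Matrix.one_mul,
    trace_mul_comm (J₂ * y), ← Matrix.mul_assoc, h.right, Matrix.one_mul]

lemma posSemidef_diagSum {x : Matrix κ₁ κ₁ ℂ} {y : Matrix κ₂ κ₂ ℂ} (hx : x.PosSemidef)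
    (hy : y.PosSemidef) : (diagSum J₁ J₂ x y).PosSemidef :=
  (hx.mul_mul_conjTranspose_same J₁).add (hy.mul_mul_conjTranspose_same J₂)

lemma mul_mpow_neg_one {x : Matrix κ κ ℂ} (hx : x.PosDef) : x * mpow x (-1) = 1 := by
  nth_rewrite 1 [← mpow_one hx.1]
  rw [mpow_mul_mpow hx, add_neg_cancel, mpow_zero _ hx.1]

lemma IsDecomposition.posDef_diagSum (h : IsDecomposition J₁ J₂) {x : Matrix κ₁ κ₁ ℂ}
    {y : Matrix κ₂ κ₂ ℂ} (hx : x.PosDef) (hy : y.PosDef) : (diagSum J₁ J₂ x y).PosDef := by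
  refine (posSemidef_diagSum hx.posSemidef hy.posSemidef).posDef_iff_isUnit.mpr ?_
  refine IsUnit.of_mul_eq_one (diagSum J₁ J₂ (mpow x (-1)) (mpow y (-1))) ?_
  rw [h.diagSum_mul_diagSum, mul_mpow_neg_one hx, mul_mpow_neg_one hy, h.diagSum_one]

lemma IsDecomposition.mpow_diagSum (h : IsDecomposition J₁ J₂) {x : Matrix κ₁ κ₁ ℂ}
    {y : Matrix κ₂ κ₂ ℂ} (hx : x.PosSemidef) (hy : y.PosSemidef) (r : ℝ) :
    mpow (diagSum J₁ J₂ x y) r = diagSum J₁ J₂ (mpow x r) (mpow y r) :=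
  have hD := (posSemidef_diagSum (J₁ := J₁) (J₂ := J₂) hx hy).1
  h.eq_diagSum (mpow_intertwine hD hx.1 (h.diagSum_mul_left x y) r)
    (mpow_intertwine hD hy.1 (h.diagSum_mul_right x y) r)

lemma IsDecomposition.trPow_diagSum (h : IsDecomposition J₁ J₂) {x : Matrix κ₁ κ₁ ℂ}
    {y : Matrix κ₂ κ₂ ℂ} (hx : x.PosSemidef) (hy : y.PosSemidef) (r : ℝ) :
    trPow (diagSum J₁ J₂ x y) r = trPow x r + trPow y r := by
  rw [trPow, h.mpow_diagSum hx hy, h.trace_diagSum, Complex.add_re, trPow, trPow]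

lemma IsDecomposition.schatten_diagSum (h : IsDecomposition J₁ J₂) {p : ℝ} (hp : 1 ≤ p)
    (x : Matrix κ₁ κ₁ ℂ) (y : Matrix κ₂ κ₂ ℂ) :
    schatten p (diagSum J₁ J₂ x y) ^ p = schatten p x ^ p + schatten p y ^ p := by
  rw [schatten_rpow hp, schatten_rpow hp, schatten_rpow hp, conjTranspose_diagSum,
    h.diagSum_mul_diagSum, h.trPow_diagSum (posSemidef_conjTranspose_mul_self x)
      (posSemidef_conjTranspose_mul_self y)]

lemma posDef_conjTranspose_mul_mul {P : Matrix κ κ ℂ} (hP : P.PosDef) (hJ : J₁ᴴ * J₁ = 1) :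
    (J₁ᴴ * P * J₁).PosDef := by
  refine hP.conjTranspose_mul_mul_same fun v w hvw => ?_
  have := congrArg (fun u => J₁ᴴ *ᵥ u) hvw
  simpa [mulVec_mulVec, hJ] using this

lemma IsDecomposition.diagSum_compress (h : IsDecomposition J₁ J₂) {W : Matrix κ κ ℂ}
    (hW : J₁ * J₁ᴴ * W = W * (J₁ * J₁ᴴ)) :
    diagSum J₁ J₂ (J₁ᴴ * W * J₁) (J₂ᴴ * W * J₂) = W := by
  have h2 : J₂ * J₂ᴴ = 1 - J₁ * J₁ᴴ := by rw [← h.add, add_sub_cancel_left]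
  have h3 : J₂ * J₂ᴴ * W = W * (J₂ * J₂ᴴ) := by
    rw [h2, Matrix.sub_mul, Matrix.mul_sub, hW, Matrix.one_mul, Matrix.mul_one]
  have h4 : diagSum J₁ J₂ (J₁ᴴ * W * J₁) (J₂ᴴ * W * J₂) =
      (J₁ * J₁ᴴ * W) * (J₁ * J₁ᴴ) + (J₂ * J₂ᴴ * W) * (J₂ * J₂ᴴ) := by
    simp only [diagSum, Matrix.mul_assoc]
  have e1 : (J₁ * J₁ᴴ) * (J₁ * J₁ᴴ) = J₁ * J₁ᴴ := by
    rw [Matrix.mul_assoc, ← Matrix.mul_assoc J₁ᴴ, h.left, Matrix.one_mul]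
  have e2 : (J₂ * J₂ᴴ) * (J₂ * J₂ᴴ) = J₂ * J₂ᴴ := by
    rw [Matrix.mul_assoc, ← Matrix.mul_assoc J₂ᴴ, h.right, Matrix.one_mul]
  rw [h4, hW, h3, Matrix.mul_assoc W, Matrix.mul_assoc W, e1, e2, ← Matrix.mul_add, h.add,
    Matrix.mul_one]

lemma IsDecomposition.diagSum_comm_projection (h : IsDecomposition J₁ J₂) (x : Matrix κ₁ κ₁ ℂ)
    (y : Matrix κ₂ κ₂ ℂ) :
    J₁ * J₁ᴴ * diagSum J₁ J₂ x y = diagSum J₁ J₂ x y * (J₁ * J₁ᴴ) := by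
  have h1 : J₁ * J₁ᴴ = diagSum J₁ J₂ 1 0 := by simp [diagSum]
  rw [h1, h.diagSum_mul_diagSum, h.diagSum_mul_diagSum]
  simp

lemma mem_centralizer_projection {W : Matrix κ κ ℂ} :
    W ∈ StarSubalgebra.centralizer ℂ {J₁ * J₁ᴴ} ↔ J₁ * J₁ᴴ * W = W * (J₁ * J₁ᴴ) := by
  rw [StarSubalgebra.mem_centralizer_iff]
  simp [star_eq_conjTranspose]

/-- Pinching is the trace preserving conditional expectation onto the commutant of the projection
J₁J₁†: an element W of the commutant equals its own pinching, so tr(PW) sees only the diagonal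
blocks of P. -/
lemma IsDecomposition.isCompression (h : IsDecomposition J₁ J₂) {P : Matrix κ κ ℂ}
    (hP : P.PosDef) : IsCompression (StarSubalgebra.centralizer ℂ {J₁ * J₁ᴴ}) P
      (diagSum J₁ J₂ (J₁ᴴ * P * J₁) (J₂ᴴ * P * J₂)) where
  posDef_left := hP
  posDef_right := h.posDef_diagSum (posDef_conjTranspose_mul_mul hP h.left)
    (posDef_conjTranspose_mul_mul hP h.right)
  mem := mem_centralizer_projection.mpr (h.diagSum_comm_projection _ _)
  trace_eq W hW := by
    have hW' := h.diagSum_compress (mem_centralizer_projection.mp hW)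
    conv_rhs => rw [← hW']
    rw [h.diagSum_mul_diagSum, h.trace_diagSum]
    conv_lhs => rw [← hW']
    rw [diagSum, Matrix.mul_add, trace_add]
    congr 1
    · rw [← Matrix.mul_assoc, trace_mul_comm]
      simp only [Matrix.mul_assoc]
    · rw [← Matrix.mul_assoc, trace_mul_comm]
      simp only [Matrix.mul_assoc]

lemma sqrt_mul_sqrt_add_le {a b c d : ℝ} (ha : 0 ≤ a) (hb : 0 ≤ b) (hc : 0 ≤ c) (hd : 0 ≤ d) :
    √a * √c + √b * √d ≤ √(a + b) * √(c + d) := by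
  rw [← Real.sqrt_mul (add_nonneg ha hb)]
  refine Real.le_sqrt_of_sq_le ?_
  have h1 := Real.sq_sqrt ha
  have h2 := Real.sq_sqrt hb
  have h3 := Real.sq_sqrt hc
  have h4 := Real.sq_sqrt hd
  have e : (a + b) * (c + d) - (√a * √c + √b * √d) ^ 2 = (√a * √d - √b * √c) ^ 2 := by
    calc (a + b) * (c + d) - (√a * √c + √b * √d) ^ 2
        = (√a ^ 2 + √b ^ 2) * (√c ^ 2 + √d ^ 2) - (√a * √c + √b * √d) ^ 2 := by rw [h1, h2, h3, h4]
      _ = _ := by ring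
  linarith [sq_nonneg (√a * √d - √b * √c)]

/-- The bound of a block diagonal matrix is the maximum of the bounds of its blocks. -/
theorem IsDecomposition.hasBound_diagSum (h : IsDecomposition J₁ J₂)
    {S : StarSubalgebra ℂ (Matrix κ κ ℂ)} {S₁ : StarSubalgebra ℂ (Matrix κ₁ κ₁ ℂ)}
    {S₂ : StarSubalgebra ℂ (Matrix κ₂ κ₂ ℂ)} (hS₁ : ∀ a ∈ S, J₁ᴴ * a * J₁ ∈ S₁)
    (hS₂ : ∀ a ∈ S, J₂ᴴ * a * J₂ ∈ S₂) {p : ℝ} (hp : 1 ≤ p) {C : ℝ} (hC : 0 ≤ C)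
    {z₁ : Matrix κ₁ κ₁ ℂ} {z₂ : Matrix κ₂ κ₂ ℂ} (h₁ : HasBound S₁ p z₁ C)
    (h₂ : HasBound S₂ p z₂ C) : HasBound S p (diagSum J₁ J₂ z₁ z₂) C := by
  have hp0 : 0 < p := by linarith
  intro P hPS Q hQS hP hQ
  have cP := h.isCompression hP
  have cQ := h.isCompression hQ
  have hP₁ := posDef_conjTranspose_mul_mul hP h.left
  have hP₂ := posDef_conjTranspose_mul_mul hP h.right
  have hQ₁ := posDef_conjTranspose_mul_mul hQ h.left
  have hQ₂ := posDef_conjTranspose_mul_mul hQ h.right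
  have tr : ∀ {B : Matrix κ κ ℂ} (hB : B.PosDef),
      trPow B 1 = trPow (J₁ᴴ * B * J₁) 1 + trPow (J₂ᴴ * B * J₂) 1 := by
    intro B hB
    have := (h.isCompression hB).trace_eq 1 (one_mem _)
    rw [Matrix.mul_one, Matrix.mul_one, h.trace_diagSum] at this
    rw [trPow, trPow, trPow, mpow_one hB.1,
      mpow_one (posDef_conjTranspose_mul_mul hB h.left).1,
      mpow_one (posDef_conjTranspose_mul_mul hB h.right).1, this, Complex.add_re]
  have b₁ := h₁ _ (hS₁ P hPS) _ (hS₁ Q hQS) hP₁ hQ₁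
  have b₂ := h₂ _ (hS₂ P hPS) _ (hS₂ Q hQS) hP₂ hQ₂
  rw [tr hP, tr hQ]
  set P₁ := J₁ᴴ * P * J₁
  set P₂ := J₂ᴴ * P * J₂
  set Q₁ := J₁ᴴ * Q * J₁
  set Q₂ := J₂ᴴ * Q * J₂
  set r : ℝ := 1 / (2 * p) with hr
  set X₁ := mpow P₁ r * z₁ * mpow Q₁ r with hX₁
  set X₂ := mpow P₂ r * z₂ * mpow Q₂ r with hX₂
  have hX : diagSum J₁ J₂ X₁ X₂ = mpow (diagSum J₁ J₂ P₁ P₂) r * diagSum J₁ J₂ z₁ z₂ *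
      mpow (diagSum J₁ J₂ Q₁ Q₂) r := by
    rw [h.mpow_diagSum hP₁.posSemidef hP₂.posSemidef, h.mpow_diagSum hQ₁.posSemidef hQ₂.posSemidef,
      h.diagSum_mul_diagSum, h.diagSum_mul_diagSum]
  have hXS : diagSum J₁ J₂ X₁ X₂ ∈ StarSubalgebra.centralizer ℂ {J₁ * J₁ᴴ} :=
    mem_centralizer_projection.mpr (h.diagSum_comm_projection _ _)
  -- P and Q are replaced by their pinchings at the price of the outer factors P^r D_P^(-r) and
  -- D_Q^(-r) Q^r, which the compression estimate removes because the middle factor commutes with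
  -- J₁J₁†.
  have e : mpow P r * diagSum J₁ J₂ z₁ z₂ * mpow Q r =
      mpow P r * mpow (diagSum J₁ J₂ P₁ P₂) (-r) * diagSum J₁ J₂ X₁ X₂ *
        (mpow (diagSum J₁ J₂ Q₁ Q₂) (-r) * mpow Q r) := by
    have i1 : mpow (diagSum J₁ J₂ P₁ P₂) (-r) * mpow (diagSum J₁ J₂ P₁ P₂) r = 1 := by
      rw [mpow_mul_mpow cP.posDef_right, neg_add_cancel, mpow_zero _ cP.posDef_right.1]
    have i2 : mpow (diagSum J₁ J₂ Q₁ Q₂) r * mpow (diagSum J₁ J₂ Q₁ Q₂) (-r) = 1 := by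
      rw [mpow_mul_mpow cQ.posDef_right, add_neg_cancel, mpow_zero _ cQ.posDef_right.1]
    calc mpow P r * diagSum J₁ J₂ z₁ z₂ * mpow Q r
        = mpow P r * (mpow (diagSum J₁ J₂ P₁ P₂) (-r) * mpow (diagSum J₁ J₂ P₁ P₂) r) *
          diagSum J₁ J₂ z₁ z₂ * (mpow (diagSum J₁ J₂ Q₁ Q₂) r *
            mpow (diagSum J₁ J₂ Q₁ Q₂) (-r)) * mpow Q r := by
          rw [i1, i2, Matrix.mul_one, Matrix.mul_one]
      _ = _ := by rw [hX]; simp only [Matrix.mul_assoc]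
  rw [e]
  refine (schatten_compression_le cP cQ hXS hp).trans ?_
  have t₁ := trPow_nonneg hP₁.posSemidef 1
  have t₂ := trPow_nonneg hP₂.posSemidef 1
  have u₁ := trPow_nonneg hQ₁.posSemidef 1
  have u₂ := trPow_nonneg hQ₂.posSemidef 1
  -- Since r p = 1/2, the p-th power of each block bound is linear in √(tr P_i) √(tr Q_i), which is
  -- exactly what Cauchy–Schwarz can sum.
  have pw2 : ∀ {t u : ℝ}, 0 ≤ t → 0 ≤ u → (C * (t ^ r * u ^ r)) ^ p = C ^ p * (√t * √u) := by
    intro t u ht hu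
    rw [Real.mul_rpow hC (by positivity), Real.mul_rpow (by positivity) (by positivity),
      ← Real.rpow_mul ht, ← Real.rpow_mul hu, Real.sqrt_eq_rpow, Real.sqrt_eq_rpow,
      show r * p = 1 / 2 by rw [hr]; field_simp]
  refine (Real.rpow_le_rpow_iff (schatten_nonneg _ _) (by positivity) hp0).mp ?_
  rw [h.schatten_diagSum hp, pw2 (add_nonneg t₁ t₂) (add_nonneg u₁ u₂)]
  have c₁ := Real.rpow_le_rpow (schatten_nonneg _ _) b₁ hp0.le
  have c₂ := Real.rpow_le_rpow (schatten_nonneg _ _) b₂ hp0.le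
  rw [pw2 t₁ u₁] at c₁
  rw [pw2 t₂ u₂] at c₂
  have cs : √(trPow P₁ 1) * √(trPow Q₁ 1) + √(trPow P₂ 1) * √(trPow Q₂ 1) ≤
      √(trPow P₁ 1 + trPow P₂ 1) * √(trPow Q₁ 1 + trPow Q₂ 1) :=
    sqrt_mul_sqrt_add_le t₁ t₂ u₁ u₂
  calc schatten p X₁ ^ p + schatten p X₂ ^ p
      ≤ C ^ p * (√(trPow P₁ 1) * √(trPow Q₁ 1)) + C ^ p * (√(trPow P₂ 1) * √(trPow Q₂ 1)) :=
        add_le_add c₁ c₂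
    _ = C ^ p * (√(trPow P₁ 1) * √(trPow Q₁ 1) + √(trPow P₂ 1) * √(trPow Q₂ 1)) := by ring
    _ ≤ _ := mul_le_mul_of_nonneg_left cs (Real.rpow_nonneg hC p)

end Decomposition

/-! ### Calculus of bounds -/

section BoundCalculus

variable {κ κ' : Type*} [Fintype κ] [Fintype κ'] [DecidableEq κ] [DecidableEq κ']

lemma posSemidef_fc {A : Matrix κ κ ℂ} (hA : A.IsHermitian) {f : ℝ → ℝ}
    (hf : ∀ i, 0 ≤ f (hA.eigenvalues i)) : (fc hA (fun t => (f t : ℂ))).PosSemidef := by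
  have h : fc hA (fun t => (f t : ℂ)) =
      (fc hA (fun t => (√(f t) : ℂ)))ᴴ * fc hA (fun t => (√(f t) : ℂ)) := by
    rw [fc_conjTranspose, fc_mul]
    refine fc_congr _ fun i => ?_
    rw [Complex.star_def, Complex.conj_ofReal, ← Complex.ofReal_mul, Real.mul_self_sqrt (hf i)]
  rw [h]
  exact posSemidef_conjTranspose_mul_self _

/-- Every eigenvalue of a positive semidefinite matrix is at most its trace. -/
lemma opNorm_mpow_le {P : Matrix κ κ ℂ} (hP : P.PosSemidef) {r : ℝ} (hr : 0 ≤ r) :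
    opNorm (mpow P r) ≤ trPow P 1 ^ r := by
  have ht := trPow_nonneg hP 1
  refine opNorm_le_of_posSemidef (by positivity) ?_
  have h : ((((trPow P 1 ^ r) ^ 2 : ℝ) : ℂ) • (1 : Matrix κ κ ℂ) - (mpow P r)ᴴ * mpow P r) =
      fc hP.1 (fun t => (((trPow P 1 ^ r) ^ 2 - (t ^ r) ^ 2 : ℝ) : ℂ)) := by
    rw [(isHermitian_mpow P r).eq, mpow_eq_fc hP.1, fc_mul, ← Algebra.algebraMap_eq_smul_one,
      ← fc_const hP.1, sub_eq_iff_eq_add, fc_add]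
    refine fc_congr _ fun i => ?_
    push_cast
    ring
  rw [h]
  refine posSemidef_fc _ fun i => sub_nonneg.mpr ?_
  have h0 := hP.eigenvalues_nonneg i
  have h1 : hP.1.eigenvalues i ≤ trPow P 1 := by
    rw [trPow_eq_sum hP.1]
    simp only [Real.rpow_one]
    exact Finset.single_le_sum (fun j _ => hP.eigenvalues_nonneg j) (Finset.mem_univ i)
  gcongr

variable {S : StarSubalgebra ℂ (Matrix κ κ ℂ)} {p : ℝ} {z w : Matrix κ κ ℂ} {C D : ℝ}

/-- This crude bound gives finiteness of the suprema for p < ∞. -/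
lemma hasBound_schatten (hp : 1 ≤ p) (S : StarSubalgebra ℂ (Matrix κ κ ℂ)) (z : Matrix κ κ ℂ) :
    HasBound S p z (schatten p z) := by
  intro P _ Q _ hP hQ
  refine (schatten_mul_mul_le_opNorm hp _ _ _).trans ?_
  have h1 := opNorm_mpow_le hP.posSemidef (r := 1 / (2 * p)) (by positivity)
  have h2 := opNorm_mpow_le hQ.posSemidef (r := 1 / (2 * p)) (by positivity)
  have h3 := schatten_nonneg p z
  have h4 := opNorm_nonneg (mpow Q (1 / (2 * p)))
  have h5 := Real.rpow_nonneg (trPow_nonneg hP.posSemidef 1) (1 / (2 * p))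
  calc _ ≤ trPow P 1 ^ (1 / (2 * p)) * schatten p z * trPow Q 1 ^ (1 / (2 * p)) := by gcongr
    _ = _ := by ring

lemma HasBound.add (hp : 1 ≤ p) (hz : HasBound S p z C) (hw : HasBound S p w D) :
    HasBound S p (z + w) (C + D) := by
  intro P hPS Q hQS hP hQ
  rw [Matrix.mul_add, Matrix.add_mul, add_mul]
  exact (schatten_add_le hp _ _).trans (add_le_add (hz P hPS Q hQS hP hQ) (hw P hPS Q hQS hP hQ))

lemma HasBound.smul (hp : 1 ≤ p) (hz : HasBound S p z C) (c : ℂ) :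
    HasBound S p (c • z) (‖c‖ * C) := by
  intro P hPS Q hQS hP hQ
  rw [Matrix.mul_smul, Matrix.smul_mul, schatten_smul hp, mul_assoc ‖c‖]
  exact mul_le_mul_of_nonneg_left (hz P hPS Q hQS hP hQ) (norm_nonneg c)

lemma HasBound.eq_zero (hp : 1 ≤ p) (hz : HasBound S p z 0) : z = 0 := by
  have h := hz 1 (one_mem S) 1 (one_mem S) PosDef.one PosDef.one
  rw [mpow_one_left, Matrix.one_mul, Matrix.mul_one, zero_mul] at h
  exact (schatten_eq_zero hp z).mp (le_antisymm h (schatten_nonneg _ _))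

/-- Bounds under multiplication by rectangular matrices compatible with the algebras. -/
lemma HasBound.mul_mul (hp : 1 ≤ p) (hz : HasBound S p z C) (hC : 0 ≤ C)
    {S' : StarSubalgebra ℂ (Matrix κ' κ' ℂ)} {v : Matrix κ' κ ℂ} {w : Matrix κ κ' ℂ}
    (hv : ∀ a ∈ S', vᴴ * a * v ∈ S) (hw : ∀ a ∈ S', w * a * wᴴ ∈ S) :
    HasBound S' p (v * z * w) (opNorm v * C * opNorm w) := by
  have h2p : 1 ≤ 2 * p := by linarith
  refine hasBound_of_schatten_le hp fun a ha b hb => ?_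
  have h1 : a * (v * z * w) * b = (a * v) * z * (w * b) := by simp only [Matrix.mul_assoc]
  have h2 : (a * v)ᴴ * (a * v) ∈ S := by
    have := hv _ (mul_mem (star_mem ha) ha)
    rw [star_eq_conjTranspose] at this
    simpa only [conjTranspose_mul, Matrix.mul_assoc] using this
  have h3 : (w * b) * (w * b)ᴴ ∈ S := by
    have := hw _ (mul_mem hb (star_mem hb))
    rw [star_eq_conjTranspose] at this
    simpa only [conjTranspose_mul, Matrix.mul_assoc] using this
  rw [h1]
  refine (hz.schatten_le hp hC h2 h3).trans ?_
  have h4 := schatten_two_mul_mul_le hp a v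
  have h5 := schatten_two_mul_mul_le hp bᴴ wᴴ
  rw [← conjTranspose_mul, schatten_conjTranspose h2p, schatten_conjTranspose h2p,
    opNorm_conjTranspose] at h5
  have := schatten_nonneg (2 * p) (w * b)
  have := mul_nonneg (schatten_nonneg (2 * p) a) (opNorm_nonneg v)
  calc _ ≤ C * ((schatten (2 * p) a * opNorm v) * (schatten (2 * p) b * opNorm w)) := by gcongr
    _ = _ := by ring

end BoundCalculus

/-! ### Powers of commuting matrices -/

section Commuting

variable {κ : Type*} [Fintype κ] [DecidableEq κ]

lemma sum_fc {A : Matrix κ κ ℂ} (hA : A.IsHermitian) {τ : Type*} (s : Finset τ)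
    (f : τ → ℝ → ℂ) : ∑ t ∈ s, fc hA (f t) = fc hA (fun x => ∑ t ∈ s, f t x) := by
  classical
  induction s using Finset.induction_on with
  | empty => simp [fc_const]
  | insert a s ha ih => simp only [Finset.sum_insert ha, ih, fc_add]

/-- H commutes with the spectral projections of T, and on the eigenspace of T for t the product HT
is tH, with power t^r H^r. Summing over the distinct eigenvalues gives the claim, also for singular
matrices. -/
lemma mpow_mul_of_comm {H T : Matrix κ κ ℂ} (hH : H.PosSemidef) (hT : T.PosSemidef)
    (hc : H * T = T * H) (r : ℝ) : mpow (H * T) r = mpow H r * mpow T r := by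
  classical
  have hHT : (H * T).IsHermitian := by
    rw [IsHermitian, conjTranspose_mul, hH.1.eq, hT.1.eq, hc]
  let Q : ℝ → Matrix κ κ ℂ := fun t => fc hT.1 (fun x => if x = t then 1 else 0)
  have hQ : ∑ t ∈ Finset.univ.image hT.1.eigenvalues, Q t = 1 := by
    rw [sum_fc, ← fc_one hT.1]
    refine fc_congr _ fun i => ?_
    rw [Finset.sum_ite_eq, if_pos (Finset.mem_image_of_mem _ (Finset.mem_univ i))]
  have eig : ∀ (f : ℝ → ℂ) (t : ℝ), fc hT.1 f * Q t = f t • Q t := by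
    intro f t
    have : f t • Q t = fc hT.1 (fun _ => f t) * Q t := by
      rw [fc_const, Algebra.algebraMap_eq_smul_one, Matrix.smul_mul, Matrix.one_mul]
    rw [this, fc_mul, fc_mul]
    refine fc_congr _ fun i => ?_
    split_ifs with h
    · rw [h]
    · simp
  have hHQ : ∀ t, H * Q t = Q t * H := fun t => (fc_intertwine hT.1 hT.1 hc.symm _).symm
  have key : ∀ t ∈ Finset.univ.image hT.1.eigenvalues,
      mpow (H * T) r * Q t = mpow H r * mpow T r * Q t := by
    intro t ht
    obtain ⟨i, -, rfl⟩ := Finset.mem_image.mp ht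
    set t := hT.1.eigenvalues i
    have ht0 : 0 ≤ t := hT.eigenvalues_nonneg i
    have e1 : T * Q t = (t : ℂ) • Q t := by
      have := eig (fun x => (x : ℂ)) t
      rwa [fc_id] at this
    have e2 : mpow T r * Q t = ((t ^ r : ℝ) : ℂ) • Q t := by
      rw [mpow_eq_fc hT.1]
      exact eig (fun x => ((x ^ r : ℝ) : ℂ)) t
    have htH : ((t : ℂ) • H).IsHermitian := by
      rw [IsHermitian, conjTranspose_smul, hH.1.eq, Complex.star_def, Complex.conj_ofReal]
    have e3 : H * T * Q t = Q t * ((t : ℂ) • H) := by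
      rw [Matrix.mul_assoc, e1, Matrix.mul_smul, Matrix.mul_smul, hHQ]
    rw [mpow_intertwine hHT htH e3, mpow_smul hH ht0, Matrix.mul_assoc, e2, Matrix.mul_smul,
      Matrix.mul_smul]
    congr 1
    exact (mpow_intertwine hH.1 hH.1 (hHQ t) r).symm
  calc mpow (H * T) r = ∑ t ∈ Finset.univ.image hT.1.eigenvalues, mpow (H * T) r * Q t := by
        rw [← Matrix.mul_sum, hQ, Matrix.mul_one]
    _ = ∑ t ∈ Finset.univ.image hT.1.eigenvalues, mpow H r * mpow T r * Q t :=
        Finset.sum_congr rfl key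
    _ = _ := by rw [← Matrix.mul_sum, hQ, Matrix.mul_one]

end Commuting

/-! ### Weighted norms with respect to a tracial state -/

section Weighted

variable {κ : Type*} [Fintype κ] [DecidableEq κ]

lemma lpNorm_top (σ x : Matrix κ κ ℂ) : lpNorm σ ∞ x = opNorm x := if_pos rfl

lemma lpNorm_eq_schatten (σ x : Matrix κ κ ℂ) {p : ℝ≥0∞} (hp : p ≠ ∞) :
    lpNorm σ p x =
      schatten p.toReal (mpow σ (1 / (2 * p.toReal)) * x * mpow σ (1 / (2 * p.toReal))) := by
  rw [lpNorm, if_neg hp, matAbs, mpow_mpow (posSemidef_conjTranspose_mul_self _), schatten, trPow,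
    one_div_mul_eq_div]

/-- A weight on `S` commuting with `S` whose restriction to `S` is `c` times the trace. -/
structure IsTracialWeight (S : StarSubalgebra ℂ (Matrix κ κ ℂ)) (σ : Matrix κ κ ℂ) (c : ℝ) :
    Prop where
  posDef : σ.PosDef
  pos : 0 < c
  comm : ∀ a ∈ S, σ * a = a * σ
  trace_mul : ∀ a ∈ S, trace (σ * a) = c * trace a

variable {S : StarSubalgebra ℂ (Matrix κ κ ℂ)} {σ : Matrix κ κ ℂ} {c : ℝ}

lemma IsTracialWeight.mpow_comm (h : IsTracialWeight S σ c) {a : Matrix κ κ ℂ} (ha : a ∈ S)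
    (r : ℝ) : mpow σ r * a = a * mpow σ r :=
  mpow_intertwine h.posDef.1 h.posDef.1 (h.comm a ha) r

/-- For a ∈ S the weight commutes with a, so the q-th power of the weighted Gram matrix is (a†a)^q
σ. Its trace is c tr (a†a)^q, because (a†a)^q lies in S. -/
lemma IsTracialWeight.lpNorm_two_mul (h : IsTracialWeight S σ c) {p : ℝ≥0∞} (hp : p ≠ ∞)
    (hp1 : 1 ≤ p.toReal) {a : Matrix κ κ ℂ} (ha : a ∈ S) :
    lpNorm σ (2 * p) a = c ^ (1 / (2 * p.toReal)) * schatten (2 * p.toReal) a := by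
  have h2 : (2 * p).toReal = 2 * p.toReal := by simp
  rw [lpNorm_eq_schatten σ a (ENNReal.mul_ne_top (by simp) hp), h2]
  set q := p.toReal
  have hH := posSemidef_conjTranspose_mul_self a
  have haa : aᴴ * a ∈ S := mul_mem (star_mem ha) ha
  set x := mpow σ (1 / (2 * (2 * q))) * a * mpow σ (1 / (2 * (2 * q))) with hx
  have hxx : xᴴ * x = (aᴴ * a) * mpow σ (1 / q) := by
    have e1 : x = a * mpow σ (1 / (2 * q)) := by
      rw [hx, h.mpow_comm ha, Matrix.mul_assoc, mpow_mul_mpow h.posDef]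
      congr 2
      field_simp
      norm_num
    rw [e1, conjTranspose_mul, (isHermitian_mpow σ _).eq, Matrix.mul_assoc, ← Matrix.mul_assoc aᴴ,
      ← Matrix.mul_assoc, h.mpow_comm haa, Matrix.mul_assoc, mpow_mul_mpow h.posDef]
    congr 2
    field_simp
    norm_num
  have hpow : mpow (xᴴ * x) q = mpow (aᴴ * a) q * σ := by
    rw [hxx, mpow_mul_of_comm hH (posSemidef_mpow h.posDef.posSemidef _) (h.mpow_comm haa _).symm,
      mpow_mpow h.posDef.posSemidef, one_div_mul_cancel (by positivity), mpow_one h.posDef.1]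
  have htr : trPow (xᴴ * x) q = c * trPow (aᴴ * a) q := by
    rw [trPow, hpow, trace_mul_comm, h.trace_mul _ (mpow_mem hH.1 haa q), Complex.re_ofReal_mul,
      trPow]
  rw [schatten, schatten, mul_div_cancel_left₀ q two_ne_zero, htr,
    Real.mul_rpow h.pos.le (trPow_nonneg hH _)]

lemma IsTracialWeight.lpNorm_mul_mul (h : IsTracialWeight S σ c) {p : ℝ≥0∞} (hp : p ≠ ∞)
    {a b : Matrix κ κ ℂ} (ha : a ∈ S) (hb : b ∈ S) (y : Matrix κ κ ℂ) :
    lpNorm σ p (a * y * b) = schatten p.toReal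
      (a * (mpow σ (1 / (2 * p.toReal)) * y * mpow σ (1 / (2 * p.toReal))) * b) := by
  rw [lpNorm_eq_schatten σ _ hp]
  congr 1
  calc mpow σ (1 / (2 * p.toReal)) * (a * y * b) * mpow σ (1 / (2 * p.toReal))
      = (mpow σ (1 / (2 * p.toReal)) * a) * y * (b * mpow σ (1 / (2 * p.toReal))) := by
        simp only [Matrix.mul_assoc]
    _ = _ := by
        rw [h.mpow_comm ha, ← h.mpow_comm hb]
        simp only [Matrix.mul_assoc]

/-- The quotients defining the amalgamated norm are bounded by `C` if and only if the weighted
matrix satisfies the corresponding unweighted bound. -/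
lemma IsTracialWeight.quotients_le_iff (h : IsTracialWeight S σ c) {p : ℝ≥0∞} (hp : p ≠ ∞)
    (hp1 : 1 ≤ p.toReal) (y : Matrix κ κ ℂ) {C : ℝ} (hC : 0 ≤ C) :
    (∀ r ∈ amalgamatedQuotients S σ p y, r ≤ C) ↔
      HasBound S p.toReal (mpow σ (1 / (2 * p.toReal)) * y * mpow σ (1 / (2 * p.toReal)))
        (C * c ^ (1 / p.toReal)) := by
  have h2 : 1 ≤ 2 * p.toReal := by linarith
  have hcc : c ^ (1 / (2 * p.toReal)) * c ^ (1 / (2 * p.toReal)) = c ^ (1 / p.toReal) := by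
    rw [← Real.rpow_add h.pos]
    congr 1
    field_simp
    norm_num
  have hden : ∀ {a b : Matrix κ κ ℂ}, a ∈ S → b ∈ S → lpNorm σ (2 * p) a * lpNorm σ (2 * p) b =
      c ^ (1 / p.toReal) * (schatten (2 * p.toReal) a * schatten (2 * p.toReal) b) := by
    intro a b ha hb
    rw [h.lpNorm_two_mul hp hp1 ha, h.lpNorm_two_mul hp hp1 hb, ← hcc]
    ring
  have hc := Real.rpow_pos_of_pos h.pos (1 / p.toReal)
  constructor
  · intro hq
    refine hasBound_of_schatten_le hp1 fun a ha b hb => ?_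
    -- The quotients omit zero factors, for which the bound is trivial.
    rcases eq_or_ne a 0 with rfl | ha0
    · rw [Matrix.zero_mul, Matrix.zero_mul, schatten_zero hp1, schatten_zero h2]
      simp
    rcases eq_or_ne b 0 with rfl | hb0
    · rw [Matrix.mul_zero, schatten_zero hp1, schatten_zero h2]
      simp
    have hsa : 0 < schatten (2 * p.toReal) a :=
      (schatten_nonneg _ _).lt_of_ne' (mt (schatten_eq_zero h2 a).mp ha0)
    have hsb : 0 < schatten (2 * p.toReal) b :=
      (schatten_nonneg _ _).lt_of_ne' (mt (schatten_eq_zero h2 b).mp hb0)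
    have := hq _ ⟨a, ha, b, hb, ha0, hb0, rfl⟩
    rw [h.lpNorm_mul_mul hp ha hb, hden ha hb, div_le_iff₀ (mul_pos hc (mul_pos hsa hsb))] at this
    rwa [mul_assoc C]
  · rintro hB _ ⟨a, ha, b, hb, ha0, hb0, rfl⟩
    have hsa : 0 < schatten (2 * p.toReal) a :=
      (schatten_nonneg _ _).lt_of_ne' (mt (schatten_eq_zero h2 a).mp ha0)
    have hsb : 0 < schatten (2 * p.toReal) b :=
      (schatten_nonneg _ _).lt_of_ne' (mt (schatten_eq_zero h2 b).mp hb0)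
    have haa : aᴴ * a ∈ S := mul_mem (star_mem ha) ha
    have hbb : b * bᴴ ∈ S := mul_mem hb (star_mem hb)
    rw [h.lpNorm_mul_mul hp ha hb, hden ha hb, div_le_iff₀ (mul_pos hc (mul_pos hsa hsb)),
      ← mul_assoc C]
    exact hB.schatten_le hp1 (mul_nonneg hC hc.le) haa hbb

end Weighted

/-! ### A criterion for operator space structures -/

section Criterion

/-- The isometry of `ℂ^m` onto the first coordinates of `ℂ^(m + n)`. -/
def inclLeft (m n : ℕ) : Matrix (Fin (m + n)) (Fin m) ℂ :=
  (1 : Matrix (Fin (m + n)) (Fin (m + n)) ℂ).submatrix id (Fin.castAdd n)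

/-- The isometry of `ℂ^n` onto the last coordinates of `ℂ^(m + n)`. -/
def inclRight (m n : ℕ) : Matrix (Fin (m + n)) (Fin n) ℂ :=
  (1 : Matrix (Fin (m + n)) (Fin (m + n)) ℂ).submatrix id (Fin.natAdd m)

lemma castAdd_ne_natAdd {m n : ℕ} (i : Fin m) (j : Fin n) : Fin.castAdd n i ≠ Fin.natAdd m j :=
  fun h => by
    have := congrArg Fin.val h
    simp at this
    omega

lemma isDecomposition_incl (m n : ℕ) : IsDecomposition (inclLeft m n) (inclRight m n) where
  left := by
    ext i j
    simp [inclLeft, mul_apply, one_apply]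
  right := by
    ext i j
    simp [inclRight, mul_apply, one_apply]
  orth := by
    ext i j
    simp [inclLeft, inclRight, mul_apply, one_apply, castAdd_ne_natAdd]
  add := by
    ext i j
    refine Fin.addCases (fun i => ?_) (fun i => ?_) i <;>
    refine Fin.addCases (fun j => ?_) (fun j => ?_) j <;>
    simp [inclLeft, inclRight, mul_apply, one_apply, castAdd_ne_natAdd,
      (castAdd_ne_natAdd _ _).symm]

variable {V : Type*} [AddCommGroup V] [Module ℂ V]

lemma scalarMul_inclLeft {m n : ℕ} (v : Matrix (Fin m) (Fin m) V) (w : Matrix (Fin n) (Fin n) V) :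
    scalarMul (inclLeft m n)ᴴ (blockSum v w) (inclLeft m n) = v := by
  ext i j
  simp [scalarMul, inclLeft, blockSum, one_apply]

lemma scalarMul_inclRight {m n : ℕ} (v : Matrix (Fin m) (Fin m) V) (w : Matrix (Fin n) (Fin n) V) :
    scalarMul (inclRight m n)ᴴ (blockSum v w) (inclRight m n) = w := by
  ext i j
  simp [scalarMul, inclRight, blockSum, one_apply]

/-- A family of gauges satisfying Ruan's axioms in the form of bounds is an operator space
structure. -/
lemma isOperatorSpaceStructure_of_bounds {nrm : ∀ n : ℕ, Matrix (Fin n) (Fin n) V → ℝ}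
    {B : ∀ n : ℕ, Matrix (Fin n) (Fin n) V → ℝ → Prop}
    (nonneg : ∀ n v, 0 ≤ nrm n v)
    (le_iff : ∀ n v C, 0 ≤ C → (nrm n v ≤ C ↔ B n v C))
    (zero : ∀ n v, B n v 0 → v = 0)
    (smul : ∀ n (c : ℂ) v C, 0 ≤ C → B n v C → B n (c • v) (‖c‖ * C))
    (add : ∀ n v w C D, 0 ≤ C → 0 ≤ D → B n v C → B n w D → B n (v + w) (C + D))
    (block : ∀ m n v w C, 0 ≤ C → B m v C → B n w C → B (m + n) (blockSum v w) C)
    (mul : ∀ (m n : ℕ) (a : Matrix (Fin n) (Fin m) ℂ) v (b : Matrix (Fin m) (Fin n) ℂ) C, 0 ≤ C →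
      B m v C → B n (scalarMul a v b) (opNorm a * C * opNorm b)) :
    IsOperatorSpaceStructure V nrm := by
  have bound : ∀ n v, B n v (nrm n v) := fun n v => (le_iff n v _ (nonneg n v)).mp le_rfl
  have smul_le : ∀ n (c : ℂ) v, nrm n (c • v) ≤ ‖c‖ * nrm n v := fun n c v =>
    (le_iff n _ _ (mul_nonneg (norm_nonneg c) (nonneg n v))).mpr
      (smul n c v _ (nonneg n v) (bound n v))
  have ruan_mul : ∀ (m n : ℕ) (a : Matrix (Fin n) (Fin m) ℂ) (v : Matrix (Fin m) (Fin m) V)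
      (b : Matrix (Fin m) (Fin n) ℂ), nrm n (scalarMul a v b) ≤ opNorm a * nrm m v * opNorm b :=
    fun m n a v b => (le_iff n _ _ (mul_nonneg (mul_nonneg (opNorm_nonneg a) (nonneg m v))
      (opNorm_nonneg b))).mpr (mul m n a v b _ (nonneg m v) (bound m v))
  have compress : ∀ {m n : ℕ} {J : Matrix (Fin n) (Fin m) ℂ} (v : Matrix (Fin n) (Fin n) V),
      Jᴴ * J = 1 → nrm m (scalarMul Jᴴ v J) ≤ nrm n v := by
    intro m n J v hJ
    have h1 := opNorm_le_one_of_isometry hJ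
    have h2 := opNorm_nonneg J
    refine (ruan_mul _ _ _ _ _).trans ?_
    rw [opNorm_conjTranspose]
    calc opNorm J * nrm n v * opNorm J ≤ 1 * nrm n v * 1 := by
          have := nonneg n v
          gcongr
      _ = nrm n v := by ring
  refine ⟨nonneg, fun n v => ⟨fun h => zero n v (h ▸ bound n v), ?_⟩, ?_, ?_, ?_, ruan_mul⟩
  · rintro rfl
    have := smul_le n 0 0
    rw [norm_zero, zero_mul, smul_zero] at this
    exact le_antisymm this (nonneg n 0)
  · intro n c v
    refine le_antisymm (smul_le n c v) ?_
    rcases eq_or_ne c 0 with rfl | hc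
    · rw [norm_zero, zero_mul]
      exact nonneg _ _
    · have := smul_le n c⁻¹ (c • v)
      rw [smul_smul, inv_mul_cancel₀ hc, one_smul, norm_inv] at this
      rwa [← le_inv_mul_iff₀ (norm_pos_iff.mpr hc)]
  · intro n v w
    exact (le_iff n _ _ (add_nonneg (nonneg n v) (nonneg n w))).mpr
      (add n v w _ _ (nonneg n v) (nonneg n w) (bound n v) (bound n w))
  · intro m n v w
    have h := isDecomposition_incl m n
    have hmax : 0 ≤ max (nrm m v) (nrm n w) := le_max_of_le_left (nonneg m v)
    refine le_antisymm ((le_iff _ _ _ hmax).mpr (block m n v w _ hmax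
      ((le_iff _ _ _ hmax).mp (le_max_left _ _)) ((le_iff _ _ _ hmax).mp (le_max_right _ _))))
      -- Each block is recovered by compressing the block sum with a coordinate isometry, so the
      -- axiom on products gives the lower bound.
      (max_le ?_ ?_)
    · simpa only [scalarMul_inclLeft] using compress (blockSum v w) h.left
    · simpa only [scalarMul_inclRight] using compress (blockSum v w) h.right

end Criterion

/-! ### Amplifications -/

section Amplify

variable {ι : Type*} [Fintype ι] [DecidableEq ι] {k m n : ℕ}

/-- The amplification `A ⊗ 1` of a scalar matrix. -/
def amp (ι : Type*) [DecidableEq ι] (A : Matrix (Fin n) (Fin m) ℂ) :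
    Matrix (Fin n × ι) (Fin m × ι) ℂ := A ⊗ₖ (1 : Matrix ι ι ℂ)

lemma amp_mul (A : Matrix (Fin n) (Fin m) ℂ) (B : Matrix (Fin m) (Fin k) ℂ) :
    amp ι A * amp ι B = amp ι (A * B) := by
  simp only [amp, ← mul_kronecker_mul, Matrix.one_mul]

lemma amp_conjTranspose (A : Matrix (Fin n) (Fin m) ℂ) : (amp ι A)ᴴ = amp ι Aᴴ := by
  simp only [amp, conjTranspose_kronecker, conjTranspose_one]

lemma amp_one : amp ι (1 : Matrix (Fin n) (Fin n) ℂ) = 1 := one_kronecker_one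

lemma one_kronecker_mul_amp (σ : Matrix ι ι ℂ) (A : Matrix (Fin n) (Fin m) ℂ) :
    ((1 : Matrix (Fin n) (Fin n) ℂ) ⊗ₖ σ) * amp ι A =
      amp ι A * ((1 : Matrix (Fin m) (Fin m) ℂ) ⊗ₖ σ) := by
  simp only [amp, ← mul_kronecker_mul, Matrix.one_mul, Matrix.mul_one]

lemma opNorm_amp_le (A : Matrix (Fin n) (Fin m) ℂ) : opNorm (amp ι A) ≤ opNorm A := by
  refine opNorm_le_of_posSemidef (opNorm_nonneg A) ?_
  have h := (posSemidef_of_opNorm_le (le_refl (opNorm A))).kronecker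
    (PosSemidef.one (n := ι) (R := ℂ))
  have e : (((opNorm A ^ 2 : ℝ) : ℂ) • (1 : Matrix (Fin m × ι) (Fin m × ι) ℂ) -
      (amp ι A)ᴴ * amp ι A) = (((opNorm A ^ 2 : ℝ) : ℂ) • (1 : Matrix (Fin m) (Fin m) ℂ) -
        Aᴴ * A) ⊗ₖ (1 : Matrix ι ι ℂ) := by
    rw [sub_eq_iff_eq_add, amp_conjTranspose, amp_mul, amp, ← add_kronecker, sub_add_cancel,
      smul_kronecker, one_kronecker_one]
  rw [e]
  exact h

lemma IsDecomposition.amp {A : Matrix (Fin n) (Fin m) ℂ} {B : Matrix (Fin n) (Fin k) ℂ}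
    (h : IsDecomposition A B) : IsDecomposition (amp ι A) (amp ι B) where
  left := by rw [amp_conjTranspose, amp_mul, h.left, amp_one]
  right := by rw [amp_conjTranspose, amp_mul, h.right, amp_one]
  orth := by rw [amp_conjTranspose, amp_mul, h.orth, AmalgamatedLp.amp, zero_kronecker]
  add := by
    rw [amp_conjTranspose, amp_conjTranspose, amp_mul, amp_mul, AmalgamatedLp.amp,
      AmalgamatedLp.amp, ← add_kronecker, h.add, one_kronecker_one]

variable {N M : StarSubalgebra ℂ (Matrix ι ι ℂ)}

lemma blk_amp_mul_mul (A : Matrix (Fin n) (Fin m) ℂ) (B : Matrix (Fin m) (Fin n) ℂ)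
    (X : Matrix (Fin m × ι) (Fin m × ι) ℂ) (i j : Fin n) :
    blk (amp ι A * X * amp ι B) i j = ∑ k, ∑ l, (A i k * B l j) • blk X k l := by
  ext a b
  simp only [blk, of_apply, mul_apply, amp, kroneckerMap_apply, Fintype.sum_prod_type,
    Matrix.sum_apply, Matrix.smul_apply, smul_eq_mul, one_apply, mul_ite, mul_one, mul_zero,
    ite_mul, zero_mul, Finset.sum_ite_eq, Finset.sum_ite_eq', Finset.mem_univ, if_true,
    Finset.sum_mul]
  rw [Finset.sum_comm]
  refine Finset.sum_congr rfl fun k _ => Finset.sum_congr rfl fun l _ => ?_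
  ring

lemma amp_mul_mul_mem (A : Matrix (Fin n) (Fin m) ℂ) (B : Matrix (Fin m) (Fin n) ℂ)
    {X : Matrix (Fin m × ι) (Fin m × ι) ℂ} (hX : X ∈ matrixAlgebra m N) :
    amp ι A * X * amp ι B ∈ matrixAlgebra n N := by
  intro i j
  rw [blk_amp_mul_mul]
  exact sum_mem fun k _ => sum_mem fun l _ => N.smul_mem (hX k l) _

lemma ext_blk {X Y : Matrix (Fin n × ι) (Fin n × ι) ℂ} (h : ∀ i j, blk X i j = blk Y i j) :
    X = Y := by
  ext ⟨i, a⟩ ⟨j, b⟩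
  exact congrFun (congrFun (h i j) a) b

lemma blk_matrixIdent (v : Matrix (Fin n) (Fin n) M) (i j : Fin n) :
    blk (matrixIdent n M v : Matrix (Fin n × ι) (Fin n × ι) ℂ) i j = v i j := rfl

lemma matrixIdent_scalarMul (A : Matrix (Fin n) (Fin m) ℂ) (v : Matrix (Fin m) (Fin m) M)
    (B : Matrix (Fin m) (Fin n) ℂ) :
    (matrixIdent n M (scalarMul A v B) : Matrix (Fin n × ι) (Fin n × ι) ℂ) =
      amp ι A * (matrixIdent m M v : Matrix (Fin m × ι) (Fin m × ι) ℂ) * amp ι B := by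
  refine ext_blk fun i j => ?_
  rw [blk_amp_mul_mul, blk_matrixIdent]
  simp [scalarMul, blk_matrixIdent]

lemma matrixIdent_blockSum (v : Matrix (Fin m) (Fin m) M) (w : Matrix (Fin n) (Fin n) M) :
    (matrixIdent (m + n) M (blockSum v w) :
      Matrix (Fin (m + n) × ι) (Fin (m + n) × ι) ℂ) =
      diagSum (amp ι (inclLeft m n)) (amp ι (inclRight m n))
        (matrixIdent m M v : Matrix (Fin m × ι) (Fin m × ι) ℂ)
        (matrixIdent n M w : Matrix (Fin n × ι) (Fin n × ι) ℂ) := by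
  have hadd : ∀ (X Y : Matrix (Fin (m + n) × ι) (Fin (m + n) × ι) ℂ) (i j : Fin (m + n)),
      blk (X + Y) i j = blk X i j + blk Y i j := fun _ _ _ _ => rfl
  refine ext_blk fun i j => ?_
  rw [diagSum, hadd, amp_conjTranspose, amp_conjTranspose, blk_amp_mul_mul, blk_amp_mul_mul,
    blk_matrixIdent]
  simp only [blk_matrixIdent]
  refine Fin.addCases (fun i => ?_) (fun i => ?_) i <;>
  refine Fin.addCases (fun j => ?_) (fun j => ?_) j <;>
  simp [blockSum, inclLeft, inclRight, one_apply, castAdd_ne_natAdd,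
    (castAdd_ne_natAdd _ _).symm]

/-- Both properties are checked on blocks: 1 ⊗ σ multiplies every block by σ, and the trace is the
sum of the traces of the diagonal blocks. -/
lemma isTracialWeight_ampState {σ : Matrix ι ι ℂ} {c : ℝ} (h : IsTracialWeight N σ c) (hn : n ≠ 0) :
    IsTracialWeight (matrixAlgebra n N) (ampState n σ) ((n : ℝ)⁻¹ * c) where
  posDef := by
    have hn' : (0 : ℂ) < (n : ℂ)⁻¹ := by
      have : (0 : ℝ) < (n : ℝ)⁻¹ := by positivity
      simpa using Complex.zero_lt_real.mpr this
    exact (PosDef.one.kronecker h.posDef).smul hn'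
  pos := mul_pos (by positivity) h.pos
  comm a ha := by
    rw [ampState, Matrix.smul_mul, Matrix.mul_smul]
    congr 1
    have h1 : ∀ X : Matrix (Fin n × ι) (Fin n × ι) ℂ, ∀ i j,
        blk (((1 : Matrix (Fin n) (Fin n) ℂ) ⊗ₖ σ) * X) i j = σ * blk X i j := by
      intro X i j
      ext x y
      simp [blk, mul_apply, Fintype.sum_prod_type, one_apply]
    have h2 : ∀ X : Matrix (Fin n × ι) (Fin n × ι) ℂ, ∀ i j,
        blk (X * ((1 : Matrix (Fin n) (Fin n) ℂ) ⊗ₖ σ)) i j = blk X i j * σ := by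
      intro X i j
      ext x y
      simp [blk, mul_apply, Fintype.sum_prod_type, one_apply]
    refine ext_blk fun i j => ?_
    rw [h1, h2, h.comm _ (ha i j)]
  trace_mul a ha := by
    have h1 : ∀ X : Matrix (Fin n × ι) (Fin n × ι) ℂ, trace X = ∑ i, trace (blk X i i) := by
      intro X
      rw [trace, Fintype.sum_prod_type]
      rfl
    have h2 : ∀ i, blk (((1 : Matrix (Fin n) (Fin n) ℂ) ⊗ₖ σ) * a) i i = σ * blk a i i := by
      intro i
      ext x y
      simp [blk, mul_apply, Fintype.sum_prod_type, one_apply]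
    rw [ampState, Matrix.smul_mul, trace_smul, h1, h1 a]
    simp only [h2, h.trace_mul _ (ha _ _)]
    rw [← Finset.mul_sum, smul_eq_mul]
    push_cast
    ring

end Amplify

/-! ### The amalgamated norm -/

section AmalgamatedNorm

variable {κ : Type*} [Fintype κ] [DecidableEq κ] {S : StarSubalgebra ℂ (Matrix κ κ ℂ)}

lemma lpNorm_nonneg (σ x : Matrix κ κ ℂ) (p : ℝ≥0∞) : 0 ≤ lpNorm σ p x := by
  by_cases hp : p = ∞
  · rw [hp, lpNorm_top]
    exact opNorm_nonneg x
  · rw [lpNorm_eq_schatten σ x hp]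
    exact schatten_nonneg _ _

lemma amalgamatedNorm_nonneg (S R : StarSubalgebra ℂ (Matrix κ κ ℂ)) (σ : Matrix κ κ ℂ) (p : ℝ≥0∞)
    (y : R) : 0 ≤ amalgamatedNorm S R σ p y := by
  refine Real.sSup_nonneg ?_
  rintro _ ⟨a, -, b, -, -, -, rfl⟩
  exact div_nonneg (lpNorm_nonneg _ _ _) (mul_nonneg (lpNorm_nonneg _ _ _) (lpNorm_nonneg _ _ _))

/-- The condition 0 ≤ C covers the empty set, whose supremum is 0; this occurs on level n = 0. -/
lemma sSup_le_iff_of_nonneg {s : Set ℝ} (hs : BddAbove s) {C : ℝ} (hC : 0 ≤ C) :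
    sSup s ≤ C ↔ ∀ r ∈ s, r ≤ C :=
  ⟨fun h _ hr => (le_csSup hs hr).trans h, fun h => Real.sSup_le h hC⟩

/-- Submultiplicativity bounds every quotient by the operator norm of y, and a = b = 1 attains it.
-/
lemma quotients_top_le_iff (S : StarSubalgebra ℂ (Matrix κ κ ℂ)) (σ y : Matrix κ κ ℂ) {C : ℝ}
    (hC : 0 ≤ C) : (∀ r ∈ amalgamatedQuotients S σ ∞ y, r ≤ C) ↔ opNorm y ≤ C := by
  have h2 : (2 : ℝ≥0∞) * ∞ = ∞ := ENNReal.mul_top two_ne_zero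
  constructor
  · intro h
    rcases isEmpty_or_nonempty κ with hκ | hκ
    · rw [Subsingleton.elim y 0, opNorm_zero]
      exact hC
    · have h1 : 0 < opNorm (1 : Matrix κ κ ℂ) :=
        (opNorm_nonneg _).lt_of_ne' (mt opNorm_eq_zero.mp one_ne_zero)
      have := h _ ⟨1, one_mem S, 1, one_mem S, one_ne_zero, one_ne_zero, rfl⟩
      rw [h2, lpNorm_top, lpNorm_top, Matrix.one_mul, Matrix.mul_one,
        div_le_iff₀ (mul_pos h1 h1)] at this
      exact this.trans (mul_le_of_le_one_right hC
        (mul_le_one₀ opNorm_one_le h1.le opNorm_one_le))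
  · rintro h _ ⟨a, -, b, -, ha, hb, rfl⟩
    have ha' : 0 < opNorm a := (opNorm_nonneg _).lt_of_ne' (mt opNorm_eq_zero.mp ha)
    have hb' : 0 < opNorm b := (opNorm_nonneg _).lt_of_ne' (mt opNorm_eq_zero.mp hb)
    rw [h2, lpNorm_top, lpNorm_top, lpNorm_top, div_le_iff₀ (mul_pos ha' hb')]
    calc opNorm (a * y * b) ≤ opNorm a * opNorm y * opNorm b :=
          (opNorm_mul_le _ _).trans
            (mul_le_mul_of_nonneg_right (opNorm_mul_le _ _) (opNorm_nonneg b))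
      _ ≤ opNorm a * C * opNorm b := by gcongr
      _ = _ := by ring

lemma HasBound.mono {p : ℝ} {z : Matrix κ κ ℂ} {C D : ℝ} (h : HasBound S p z C) (hCD : C ≤ D) :
    HasBound S p z D := by
  intro P hPS Q hQS hP hQ
  refine (h P hPS Q hQS hP hQ).trans (mul_le_mul_of_nonneg_right hCD ?_)
  exact mul_nonneg (Real.rpow_nonneg (trPow_nonneg hP.posSemidef 1) _)
    (Real.rpow_nonneg (trPow_nonneg hQ.posSemidef 1) _)

lemma hasBound_smul_iff {p : ℝ} (hp : 1 ≤ p) {z : Matrix κ κ ℂ} {C t : ℝ} (ht : 0 < t) :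
    HasBound S p ((t : ℂ) • z) (t * C) ↔ HasBound S p z C := by
  have hn : ∀ {s : ℝ}, 0 < s → ‖(s : ℂ)‖ = s := fun hs => by
    rw [Complex.norm_real, Real.norm_of_nonneg hs.le]
  constructor
  · intro h
    have := h.smul hp ((t⁻¹ : ℝ) : ℂ)
    rwa [hn (inv_pos.mpr ht), smul_smul, ← Complex.ofReal_mul, ← mul_assoc, inv_mul_cancel₀ ht.ne',
      one_mul, Complex.ofReal_one, one_smul] at this
  · intro h
    have := h.smul hp (t : ℂ)
    rwa [hn ht] at this

end AmalgamatedNorm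

/-! ### The matrix norms -/

section MatrixNorm

variable {ι : Type*} [Fintype ι] [DecidableEq ι] {N M : StarSubalgebra ℂ (Matrix ι ι ℂ)}
  {σ : Matrix ι ι ℂ} {c : ℝ}

lemma posDef_one_kronecker (hσ : σ.PosDef) (n : ℕ) :
    ((1 : Matrix (Fin n) (Fin n) ℂ) ⊗ₖ σ).PosDef := PosDef.one.kronecker hσ

/-- The matrix `(1 ⊗ σ^r) y (1 ⊗ σ^r)`. -/
def weighted (σ : Matrix ι ι ℂ) (r : ℝ) (n : ℕ) (y : Matrix (Fin n × ι) (Fin n × ι) ℂ) :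
    Matrix (Fin n × ι) (Fin n × ι) ℂ :=
  mpow ((1 : Matrix (Fin n) (Fin n) ℂ) ⊗ₖ σ) r * y * mpow ((1 : Matrix (Fin n) (Fin n) ℂ) ⊗ₖ σ) r

lemma weighted_add (r : ℝ) {n : ℕ} (x y : Matrix (Fin n × ι) (Fin n × ι) ℂ) :
    weighted σ r n (x + y) = weighted σ r n x + weighted σ r n y := by
  simp only [weighted, Matrix.mul_add, Matrix.add_mul]

lemma weighted_smul (r : ℝ) {n : ℕ} (t : ℂ) (x : Matrix (Fin n × ι) (Fin n × ι) ℂ) :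
    weighted σ r n (t • x) = t • weighted σ r n x := by
  simp only [weighted, Matrix.mul_smul, Matrix.smul_mul]

lemma eq_zero_of_weighted_eq_zero (hσ : σ.PosDef) (r : ℝ) {n : ℕ}
    {x : Matrix (Fin n × ι) (Fin n × ι) ℂ} (h : weighted σ r n x = 0) : x = 0 := by
  have hP := posDef_one_kronecker hσ n
  set ρ := (1 : Matrix (Fin n) (Fin n) ℂ) ⊗ₖ σ
  have h1 : mpow ρ (-r) * mpow ρ r = 1 := by
    rw [mpow_mul_mpow hP, neg_add_cancel, mpow_zero _ hP.1]
  have h2 : mpow ρ r * mpow ρ (-r) = 1 := by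
    rw [mpow_mul_mpow hP, add_neg_cancel, mpow_zero _ hP.1]
  calc x = (mpow ρ (-r) * mpow ρ r) * x * (mpow ρ r * mpow ρ (-r)) := by
        rw [h1, h2, Matrix.one_mul, Matrix.mul_one]
    _ = mpow ρ (-r) * weighted σ r n x * mpow ρ (-r) := by
        simp only [weighted, Matrix.mul_assoc, ρ]
    _ = 0 := by rw [h, Matrix.mul_zero, Matrix.zero_mul]

lemma mpow_mul_amp (hσ : σ.PosDef) (r : ℝ) {m n : ℕ} (A : Matrix (Fin n) (Fin m) ℂ) :
    mpow ((1 : Matrix (Fin n) (Fin n) ℂ) ⊗ₖ σ) r * amp ι A =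
      amp ι A * mpow ((1 : Matrix (Fin m) (Fin m) ℂ) ⊗ₖ σ) r :=
  mpow_intertwine (posDef_one_kronecker hσ n).1 (posDef_one_kronecker hσ m).1
    (one_kronecker_mul_amp σ A) r

lemma weighted_amp (hσ : σ.PosDef) (r : ℝ) {m n : ℕ} (A : Matrix (Fin n) (Fin m) ℂ)
    (x : Matrix (Fin m × ι) (Fin m × ι) ℂ) (B : Matrix (Fin m) (Fin n) ℂ) :
    weighted σ r n (amp ι A * x * amp ι B) = amp ι A * weighted σ r m x * amp ι B := by
  calc weighted σ r n (amp ι A * x * amp ι B)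
      = (mpow ((1 : Matrix (Fin n) (Fin n) ℂ) ⊗ₖ σ) r * amp ι A) * x *
        (amp ι B * mpow ((1 : Matrix (Fin n) (Fin n) ℂ) ⊗ₖ σ) r) := by
        simp only [weighted, Matrix.mul_assoc]
    _ = _ := by
        rw [mpow_mul_amp hσ r A, ← mpow_mul_amp hσ r B]
        simp only [weighted, Matrix.mul_assoc]

/-- Boundedness of the quotients on the `n`-th matrix level, in unweighted form and with a
constant which does not depend on `n`. -/
lemma IsTracialWeight.quotients_amp_le_iff (h : IsTracialWeight N σ c) {p : ℝ≥0∞} (hp : p ≠ ∞)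
    (hp1 : 1 ≤ p.toReal) (n : ℕ) (y : Matrix (Fin n × ι) (Fin n × ι) ℂ) {C : ℝ} (hC : 0 ≤ C) :
    (∀ r ∈ amalgamatedQuotients (matrixAlgebra n N) (ampState n σ) p y, r ≤ C) ↔
      HasBound (matrixAlgebra n N) p.toReal (weighted σ (1 / (2 * p.toReal)) n y)
        (C * c ^ (1 / p.toReal)) := by
  -- For n = 0 the state is not a tracial weight with positive constant, but there are no nonzero
  -- matrices and both sides hold trivially.
  rcases eq_or_ne n 0 with rfl | hn
  · constructor
    · intro _ P _ Q _ hP hQ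
      rw [Subsingleton.elim (mpow P _ * _ * _) 0, schatten_zero hp1]
      exact mul_nonneg (mul_nonneg hC (Real.rpow_nonneg h.pos.le _))
        (mul_nonneg (Real.rpow_nonneg (trPow_nonneg hP.posSemidef 1) _)
          (Real.rpow_nonneg (trPow_nonneg hQ.posSemidef 1) _))
    · rintro _ _ ⟨a, -, b, -, ha, -⟩
      exact absurd (Subsingleton.elim a 0) ha
  · have hn0 : (0 : ℝ) < (n : ℝ)⁻¹ := by positivity
    rw [(isTracialWeight_ampState h hn).quotients_le_iff hp hp1 y hC]
    set q := p.toReal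
    have e1 : mpow (ampState n σ) (1 / (2 * q)) = ((((n : ℝ)⁻¹) ^ (1 / (2 * q)) : ℝ) : ℂ) •
        mpow ((1 : Matrix (Fin n) (Fin n) ℂ) ⊗ₖ σ) (1 / (2 * q)) := by
      rw [← mpow_smul (posDef_one_kronecker h.posDef n).posSemidef hn0.le, ampState]
      push_cast
      rfl
    have e2 : ((n : ℝ)⁻¹) ^ (1 / (2 * q)) * ((n : ℝ)⁻¹) ^ (1 / (2 * q)) =
        ((n : ℝ)⁻¹) ^ (1 / q) := by
      rw [← Real.rpow_add hn0]
      congr 1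
      field_simp
      norm_num
    have e3 : mpow (ampState n σ) (1 / (2 * q)) * y * mpow (ampState n σ) (1 / (2 * q)) =
        ((((n : ℝ)⁻¹) ^ (1 / q) : ℝ) : ℂ) • weighted σ (1 / (2 * q)) n y := by
      rw [e1, weighted, ← e2, Matrix.smul_mul, Matrix.smul_mul, Matrix.mul_smul, smul_smul,
        Complex.ofReal_mul]
    -- The factor n^(-1/p) arises once from the weight around y and once from the tracial constant,
    -- and cancels.
    have e4 : C * ((n : ℝ)⁻¹ * c) ^ (1 / q) = ((n : ℝ)⁻¹) ^ (1 / q) * (C * c ^ (1 / q)) := by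
      rw [Real.mul_rpow hn0.le h.pos.le]
      ring
    rw [e3, e4, hasBound_smul_iff hp1 (Real.rpow_pos_of_pos hn0 _)]

lemma IsTracialWeight.bddAbove_amp (h : IsTracialWeight N σ c) {p : ℝ≥0∞} (hp1 : 1 ≤ p)
    (n : ℕ) (y : Matrix (Fin n × ι) (Fin n × ι) ℂ) :
    BddAbove (amalgamatedQuotients (matrixAlgebra n N) (ampState n σ) p y) := by
  by_cases hp : p = ∞
  · subst hp
    exact ⟨opNorm y, (quotients_top_le_iff _ _ _ (opNorm_nonneg y)).mpr le_rfl⟩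
  · have hq : 1 ≤ p.toReal := by
      simpa using (ENNReal.toReal_le_toReal ENNReal.one_ne_top hp).mpr hp1
    have hc := Real.rpow_pos_of_pos h.pos (1 / p.toReal)
    refine ⟨schatten p.toReal (weighted σ (1 / (2 * p.toReal)) n y) / c ^ (1 / p.toReal),
      (h.quotients_amp_le_iff hp hq n y (div_nonneg (schatten_nonneg _ _) hc.le)).mpr ?_⟩
    rw [div_mul_cancel₀ _ hc.ne']
    exact hasBound_schatten hq _ _

lemma matrixAlgebra_compress (n m : ℕ) (A : Matrix (Fin n) (Fin m) ℂ) :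
    ∀ a ∈ matrixAlgebra n N, (amp ι A)ᴴ * a * amp ι A ∈ matrixAlgebra m N := fun a ha => by
  rw [amp_conjTranspose]
  exact amp_mul_mul_mem _ _ ha

lemma IsTracialWeight.isOperatorSpaceStructure (h : IsTracialWeight N σ c) {p : ℝ≥0∞}
    (hp1 : 1 ≤ p) : IsOperatorSpaceStructure M (matrixNorm N M σ p) := by
  have hbdd := fun (n : ℕ) (v : Matrix (Fin n) (Fin n) M) =>
    h.bddAbove_amp hp1 n (matrixIdent n M v : Matrix (Fin n × ι) (Fin n × ι) ℂ)
  have ident_zero : ∀ (n : ℕ) (v : Matrix (Fin n) (Fin n) M),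
      (matrixIdent n M v : Matrix (Fin n × ι) (Fin n × ι) ℂ) = 0 → v = 0 := fun n v hv =>
    (matrixIdent n M).map_eq_zero_iff.mp (Subtype.ext hv)
  by_cases hp : p = ∞
  · subst hp
    refine isOperatorSpaceStructure_of_bounds
      (B := fun n v C => opNorm (matrixIdent n M v : Matrix (Fin n × ι) (Fin n × ι) ℂ) ≤ C)
      (fun n v => amalgamatedNorm_nonneg _ _ _ _ _) (fun n v C hC => ?_) (fun n v hv => ?_)
      (fun n t v C hC hv => ?_) (fun n v w C D _ _ hv hw => ?_) (fun m n v w C hC hv hw => ?_)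
      (fun m n a v b C hC hv => ?_)
    · exact (sSup_le_iff_of_nonneg (hbdd n v) hC).trans (quotients_top_le_iff _ _ _ hC)
    · exact ident_zero n v (opNorm_eq_zero.mp (le_antisymm hv (opNorm_nonneg _)))
    · rw [map_smul]
      refine (opNorm_smul t _).le.trans ?_
      gcongr
    · rw [map_add]
      exact (opNorm_add_le _ _).trans (add_le_add hv hw)
    · have hd := (isDecomposition_incl m n).amp (ι := ι)
      rw [matrixIdent_blockSum]
      refine opNorm_le_of_posSemidef hC ?_
      rw [conjTranspose_diagSum, hd.diagSum_mul_diagSum]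
      -- C² · 1 is itself block diagonal, so positivity of the difference can be checked on each
      -- block.
      have e : ((C ^ 2 : ℝ) : ℂ) • (1 : Matrix (Fin (m + n) × ι) (Fin (m + n) × ι) ℂ) =
          diagSum (amp ι (inclLeft m n)) (amp ι (inclRight m n))
            (((C ^ 2 : ℝ) : ℂ) • 1) (((C ^ 2 : ℝ) : ℂ) • 1) := by
        rw [← hd.diagSum_one]
        simp only [diagSum, Matrix.mul_smul, Matrix.smul_mul, smul_add]
      have e2 : ∀ x x' y y', diagSum (amp ι (inclLeft m n)) (amp ι (inclRight m n)) x y -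
          diagSum (amp ι (inclLeft m n)) (amp ι (inclRight m n)) x' y' =
          diagSum (amp ι (inclLeft m n)) (amp ι (inclRight m n)) (x - x') (y - y') := by
        intro x x' y y'
        simp only [diagSum, Matrix.mul_sub, Matrix.sub_mul]
        abel
      rw [e, e2]
      exact posSemidef_diagSum (posSemidef_of_opNorm_le hv) (posSemidef_of_opNorm_le hw)
    · rw [matrixIdent_scalarMul]
      have h1 := opNorm_amp_le (ι := ι) a
      have h2 := opNorm_amp_le (ι := ι) b
      have h3 := opNorm_nonneg (amp ι b)
      have h4 := opNorm_nonneg a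
      calc _ ≤ opNorm (amp ι a) * opNorm (matrixIdent m M v : Matrix (Fin m × ι) (Fin m × ι) ℂ) *
            opNorm (amp ι b) := (opNorm_mul_le _ _).trans
              (mul_le_mul_of_nonneg_right (opNorm_mul_le _ _) h3)
        _ ≤ _ := by
          have := opNorm_nonneg (matrixIdent m M v : Matrix (Fin m × ι) (Fin m × ι) ℂ)
          gcongr
  · have hq : 1 ≤ p.toReal := by
      simpa using (ENNReal.toReal_le_toReal ENNReal.one_ne_top hp).mpr hp1
    set q := p.toReal with hqdef
    have hc := Real.rpow_pos_of_pos h.pos (1 / q)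
    refine isOperatorSpaceStructure_of_bounds
      (B := fun n v C => HasBound (matrixAlgebra n N) q (weighted σ (1 / (2 * q)) n
        (matrixIdent n M v : Matrix (Fin n × ι) (Fin n × ι) ℂ)) (C * c ^ (1 / q)))
      (fun n v => amalgamatedNorm_nonneg _ _ _ _ _) (fun n v C hC => ?_) (fun n v hv => ?_)
      (fun n t v C hC hv => ?_) (fun n v w C D _ _ hv hw => ?_) (fun m n v w C hC hv hw => ?_)
      (fun m n a v b C hC hv => ?_)
    · exact (sSup_le_iff_of_nonneg (hbdd n v) hC).trans (h.quotients_amp_le_iff hp hq _ _ hC)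
    · rw [zero_mul] at hv
      exact ident_zero n v (eq_zero_of_weighted_eq_zero h.posDef _ (hv.eq_zero hq))
    · have := hv.smul hq t
      rw [← weighted_smul, ← mul_assoc] at this
      rw [map_smul]
      exact this
    · have := hv.add hq hw
      rw [← weighted_add, ← add_mul] at this
      rw [map_add]
      exact this
    · have hd := isDecomposition_incl m n
      have hb := (hd.amp (ι := ι)).hasBound_diagSum (matrixAlgebra_compress (N := N) _ _ _)
        (matrixAlgebra_compress (N := N) _ _ _) hq (mul_nonneg hC hc.le) hv hw
      -- The weight 1 ⊗ σ^r commutes with amplified scalar matrices, so weighting acts on each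
      -- diagonal block separately.
      have e : weighted σ (1 / (2 * q)) (m + n) (matrixIdent (m + n) M (blockSum v w) :
          Matrix (Fin (m + n) × ι) (Fin (m + n) × ι) ℂ) =
          diagSum (amp ι (inclLeft m n)) (amp ι (inclRight m n))
            (weighted σ (1 / (2 * q)) m (matrixIdent m M v : Matrix (Fin m × ι) (Fin m × ι) ℂ))
            (weighted σ (1 / (2 * q)) n
              (matrixIdent n M w : Matrix (Fin n × ι) (Fin n × ι) ℂ)) := by
        rw [matrixIdent_blockSum]
        simp only [diagSum, amp_conjTranspose, weighted_add, weighted_amp h.posDef]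
      rw [e]
      exact hb
    · rw [matrixIdent_scalarMul, weighted_amp h.posDef]
      have hb := hv.mul_mul hq (mul_nonneg hC hc.le) (S' := matrixAlgebra n N) (v := amp ι a)
        (w := amp ι b) (matrixAlgebra_compress (N := N) _ _ _) (fun x hx => by
          rw [amp_conjTranspose]
          exact amp_mul_mul_mem _ _ hx)
      refine hb.mono ?_
      have h1 := opNorm_amp_le (ι := ι) a
      have h2 := opNorm_amp_le (ι := ι) b
      have h3 := opNorm_nonneg (amp ι b)
      have h4 := opNorm_nonneg a
      calc _ ≤ opNorm a * (C * c ^ (1 / q)) * opNorm b := by gcongr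
        _ = _ := by ring

/-! ### The first matrix level -/

/-- The canonical unitary from `ℂ^ι` to `ℂ^1 ⊗ ℂ^ι`. -/
def inclOne (ι : Type*) [DecidableEq ι] : Matrix (Fin 1 × ι) ι ℂ :=
  (1 : Matrix ι ι ℂ).submatrix Prod.snd id

lemma inclOne_isometry : (inclOne ι)ᴴ * inclOne ι = 1 := by
  ext i j
  simp [inclOne, mul_apply, one_apply, Fintype.sum_prod_type]
  split_ifs <;> simp

lemma inclOne_mul_mul_conjTranspose (x : Matrix ι ι ℂ) :
    inclOne ι * x * (inclOne ι)ᴴ = x.submatrix Prod.snd Prod.snd := by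
  ext i j
  simp [inclOne, mul_apply, one_apply]

lemma conjTranspose_inclOne_mul_mul (x : Matrix (Fin 1 × ι) (Fin 1 × ι) ℂ) :
    (inclOne ι)ᴴ * x * inclOne ι = blk x 0 0 := by
  ext i j
  simp [inclOne, mul_apply, one_apply, blk, Fintype.sum_prod_type]

lemma inclOne_intertwine (σ : Matrix ι ι ℂ) :
    ((1 : Matrix (Fin 1) (Fin 1) ℂ) ⊗ₖ σ) * inclOne ι = inclOne ι * σ := by
  ext i j
  simp [inclOne, mul_apply, one_apply, Fintype.sum_prod_type, Subsingleton.elim i.1 0]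

lemma matrixIdent_one (y : M) : (matrixIdent 1 M (Matrix.of fun _ _ => y) :
    Matrix (Fin 1 × ι) (Fin 1 × ι) ℂ) = inclOne ι * (y : Matrix ι ι ℂ) * (inclOne ι)ᴴ := by
  rw [inclOne_mul_mul_conjTranspose]
  rfl

lemma IsTracialWeight.matrixNorm_one (h : IsTracialWeight N σ c) {p : ℝ≥0∞} (hp1 : 1 ≤ p) (y : M) :
    matrixNorm N M σ p 1 (Matrix.of fun _ _ => y) = amalgamatedNorm N M σ p y := by
  have hb1 := h.bddAbove_amp hp1 1
    (matrixIdent 1 M (Matrix.of fun _ _ => y) : Matrix (Fin 1 × ι) (Fin 1 × ι) ℂ)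
  have hJ : opNorm (inclOne ι) ≤ 1 := opNorm_le_one_of_isometry inclOne_isometry
  have hJ' : opNorm (inclOne ι)ᴴ ≤ 1 := by rwa [opNorm_conjTranspose]
  -- Two bounded sets of quotients with the same nonnegative upper bounds have the same supremum.
  -- The sets themselves need not be compared.
  suffices hs : BddAbove (amalgamatedQuotients N σ p (y : Matrix ι ι ℂ)) ∧ ∀ C : ℝ, 0 ≤ C →
      ((∀ r ∈ amalgamatedQuotients (matrixAlgebra 1 N) (ampState 1 σ) p
        (matrixIdent 1 M (Matrix.of fun _ _ => y) : Matrix (Fin 1 × ι) (Fin 1 × ι) ℂ), r ≤ C) ↔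
      ∀ r ∈ amalgamatedQuotients N σ p (y : Matrix ι ι ℂ), r ≤ C) by
    obtain ⟨hb2, hiff⟩ := hs
    have n1 : 0 ≤ matrixNorm N M σ p 1 (Matrix.of fun _ _ => y) := amalgamatedNorm_nonneg _ _ _ _ _
    have n2 := amalgamatedNorm_nonneg N M σ p y
    refine le_antisymm ?_ ?_
    · exact (sSup_le_iff_of_nonneg hb1 n2).mpr ((hiff _ n2).mpr
        ((sSup_le_iff_of_nonneg hb2 n2).mp le_rfl))
    · exact (sSup_le_iff_of_nonneg hb2 n1).mpr ((hiff _ n1).mp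
        ((sSup_le_iff_of_nonneg hb1 n1).mp le_rfl))
  have cancel : ∀ x : Matrix ι ι ℂ,
      (inclOne ι)ᴴ * (inclOne ι * x * (inclOne ι)ᴴ) * inclOne ι = x := by
    intro x
    calc (inclOne ι)ᴴ * (inclOne ι * x * (inclOne ι)ᴴ) * inclOne ι
        = ((inclOne ι)ᴴ * inclOne ι) * x * ((inclOne ι)ᴴ * inclOne ι) := by
          simp only [Matrix.mul_assoc]
      _ = x := by rw [inclOne_isometry, Matrix.one_mul, Matrix.mul_one]
  have le_of_contr : ∀ {s t C : ℝ}, 0 ≤ s → s ≤ 1 → 0 ≤ t → t ≤ 1 → 0 ≤ C → s * C * t ≤ C := by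
    intro s t C hs hs1 ht ht1 hC
    calc s * C * t ≤ 1 * C * 1 := by gcongr
      _ = C := by ring
  by_cases hp : p = ∞
  · subst hp
    refine ⟨⟨opNorm (y : Matrix ι ι ℂ),
      (quotients_top_le_iff _ _ _ (opNorm_nonneg _)).mpr le_rfl⟩, fun C hC => ?_⟩
    rw [quotients_top_le_iff _ _ _ hC, quotients_top_le_iff _ _ _ hC, matrixIdent_one]
    constructor
    · intro hle
      rw [← cancel (y : Matrix ι ι ℂ)]
      refine ((opNorm_mul_le _ _).trans (mul_le_mul_of_nonneg_right (opNorm_mul_le _ _)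
        (opNorm_nonneg _))).trans ((le_of_contr (opNorm_nonneg _) hJ' (opNorm_nonneg _) hJ
          (opNorm_nonneg _)).trans hle)
    · intro hle
      refine ((opNorm_mul_le _ _).trans (mul_le_mul_of_nonneg_right (opNorm_mul_le _ _)
        (opNorm_nonneg _))).trans ((le_of_contr (opNorm_nonneg _) hJ (opNorm_nonneg _) hJ'
          (opNorm_nonneg _)).trans hle)
  · have hq : 1 ≤ p.toReal := by
      simpa using (ENNReal.toReal_le_toReal ENNReal.one_ne_top hp).mpr hp1
    have hc := Real.rpow_pos_of_pos h.pos (1 / p.toReal)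
    refine ⟨⟨schatten p.toReal (mpow σ (1 / (2 * p.toReal)) * (y : Matrix ι ι ℂ) *
      mpow σ (1 / (2 * p.toReal))) / c ^ (1 / p.toReal), (h.quotients_le_iff hp hq _
        (div_nonneg (schatten_nonneg _ _) hc.le)).mpr ?_⟩, fun C hC => ?_⟩
    · rw [div_mul_cancel₀ _ hc.ne']
      exact hasBound_schatten hq _ _
    have hCc := mul_nonneg hC hc.le
    rw [h.quotients_amp_le_iff hp hq _ _ hC, h.quotients_le_iff hp hq _ hC, matrixIdent_one]
    set q := p.toReal
    have hint := mpow_intertwine (posDef_one_kronecker h.posDef 1).1 h.posDef.1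
      (inclOne_intertwine σ) (1 / (2 * q))
    have hint' := congrArg conjTranspose hint
    rw [conjTranspose_mul, conjTranspose_mul, (isHermitian_mpow _ _).eq,
      (isHermitian_mpow σ _).eq] at hint'
    have hw : weighted σ (1 / (2 * q)) 1 (inclOne ι * (y : Matrix ι ι ℂ) * (inclOne ι)ᴴ) =
        inclOne ι * (mpow σ (1 / (2 * q)) * (y : Matrix ι ι ℂ) * mpow σ (1 / (2 * q))) *
          (inclOne ι)ᴴ := by
      calc _ = (mpow ((1 : Matrix (Fin 1) (Fin 1) ℂ) ⊗ₖ σ) (1 / (2 * q)) * inclOne ι) *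
            (y : Matrix ι ι ℂ) * ((inclOne ι)ᴴ *
              mpow ((1 : Matrix (Fin 1) (Fin 1) ℂ) ⊗ₖ σ) (1 / (2 * q))) := by
            simp only [weighted, Matrix.mul_assoc]
        _ = _ := by
            rw [hint, hint']
            simp only [Matrix.mul_assoc]
    rw [hw]
    have m1 : ∀ a ∈ N, inclOne ι * a * (inclOne ι)ᴴ ∈ matrixAlgebra 1 N := fun a ha i j => by
      rw [inclOne_mul_mul_conjTranspose]
      exact ha
    have m2 : ∀ a ∈ matrixAlgebra 1 N, (inclOne ι)ᴴ * a * inclOne ι ∈ N := fun a ha => by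
      rw [conjTranspose_inclOne_mul_mul]
      exact ha 0 0
    -- Both directions are the multiplication estimate for `inclOne` and its adjoint, which are
    -- contractions carrying the two algebras into each other.
    constructor
    · intro hB
      have := hB.mul_mul hq hCc (S' := N) (v := (inclOne ι)ᴴ) (w := inclOne ι)
        (fun a ha => by rw [conjTranspose_conjTranspose]; exact m1 a ha) m1
      rw [cancel] at this
      exact this.mono (le_of_contr (opNorm_nonneg _) hJ' (opNorm_nonneg _) hJ hCc)
    · intro hB
      have := hB.mul_mul hq hCc (S' := matrixAlgebra 1 N) (v := inclOne ι) (w := (inclOne ι)ᴴ)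
        m2 (fun a ha => by rw [conjTranspose_conjTranspose]; exact m2 a ha)
      exact this.mono (le_of_contr (opNorm_nonneg _) hJ (opNorm_nonneg _) hJ' hCc)

/-! ### The invariant state -/

/-- The invariant state commutes with `N` and restricts to the normalized trace on `N`. -/
lemma exists_isTracialWeight (hNM : N ≤ M) {E : M →ₗ[ℂ] N} (hE : IsConditionalExpectation hNM E)
    (hσ : (invariantState hNM E).PosDef) : ∃ c, IsTracialWeight N (invariantState hNM E) c := by
  set s : M := traceAdjoint hNM E ((Matrix.trace (1 : Matrix ι ι ℂ))⁻¹ • (1 : M)) with hs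
  have hval : invariantState hNM E = (s : Matrix ι ι ℂ) := rfl
  have htr : ∀ Y : M, trace ((s : Matrix ι ι ℂ) * (Y : Matrix ι ι ℂ)) =
      (Matrix.trace (1 : Matrix ι ι ℂ))⁻¹ * trace (E Y : Matrix ι ι ℂ) := by
    intro Y
    rw [hs, trace_traceAdjoint_mul]
    simp
  have hcomm : ∀ a ∈ N, (s : Matrix ι ι ℂ) * a = a * (s : Matrix ι ι ℂ) := by
    intro a ha
    let a' : M := StarSubalgebra.inclusion hNM ⟨a, ha⟩
    have hl : ∀ Y : M, E (a' * Y) = ⟨a, ha⟩ * E Y := fun Y => by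
      have := hE.map_bimodule ⟨a, ha⟩ 1 Y
      rwa [map_one, mul_one, mul_one] at this
    have hr : ∀ Y : M, E (Y * a') = E Y * ⟨a, ha⟩ := fun Y => by
      have := hE.map_bimodule 1 ⟨a, ha⟩ Y
      rwa [map_one, one_mul, one_mul] at this
    -- With d = tr 1, tr(s a'Y) = d⁻¹ tr(a E(Y)) = d⁻¹ tr(E(Y) a) = tr(s Y a'), so the commutator of
    -- s and a' is orthogonal to M in the trace form and vanishes by nondegeneracy.
    have hz : ∀ Y : M, trForm M (s * a' - a' * s) Y = 0 := by
      intro Y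
      have h1 := htr (a' * Y)
      have h2 := htr (Y * a')
      rw [hl] at h1
      rw [hr] at h2
      have h3 : trace ((E Y * ⟨a, ha⟩ : N) : Matrix ι ι ℂ) =
          trace ((⟨a, ha⟩ * E Y : N) : Matrix ι ι ℂ) := trace_mul_comm _ _
      rw [h3, ← h1] at h2
      have h4 : trForm M (s * a' - a' * s) Y =
          trace ((((s * a' : M) : Matrix ι ι ℂ) - ((a' * s : M) : Matrix ι ι ℂ)) *
            (Y : Matrix ι ι ℂ)) := rfl
      rw [h4, Matrix.sub_mul, trace_sub, sub_eq_zero]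
      calc trace (((s * a' : M) : Matrix ι ι ℂ) * (Y : Matrix ι ι ℂ))
          = trace ((s : Matrix ι ι ℂ) * ((a' * Y : M) : Matrix ι ι ℂ)) := by
            rw [MulMemClass.coe_mul, MulMemClass.coe_mul, Matrix.mul_assoc]
        _ = trace ((s : Matrix ι ι ℂ) * ((Y * a' : M) : Matrix ι ι ℂ)) := h2.symm
        _ = _ := by
            rw [MulMemClass.coe_mul, MulMemClass.coe_mul, ← Matrix.mul_assoc, trace_mul_comm,
              ← Matrix.mul_assoc]
    have h0 : s * a' - a' * s = 0 := (nondegenerate_trForm M).1 _ hz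
    have := congrArg (fun x : M => (x : Matrix ι ι ℂ)) (sub_eq_zero.mp h0)
    exact this
  have htrN : ∀ a ∈ N, trace ((s : Matrix ι ι ℂ) * a) =
      (Matrix.trace (1 : Matrix ι ι ℂ))⁻¹ * trace a := by
    intro a ha
    have := htr (StarSubalgebra.inclusion hNM ⟨a, ha⟩)
    rw [hE.map_inclusion] at this
    exact this
  -- For empty ι the constant 1/d would be 0; any positive constant works there.
  rcases isEmpty_or_nonempty ι with hι | hι
  · exact ⟨1, hσ, one_pos, fun a ha => Subsingleton.elim _ _, fun a ha => by
      simp [Matrix.trace]⟩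
  · refine ⟨(Fintype.card ι : ℝ)⁻¹, hσ, by positivity, hcomm, fun a ha => ?_⟩
    rw [hval, htrN a ha, trace_one]
    push_cast
    rfl

end MatrixNorm

end AmalgamatedLp

end

theorem mainTheorem9 {ι : Type*} [Fintype ι] [DecidableEq ι]
    (N M : StarSubalgebra ℂ (Matrix ι ι ℂ)) (h : N ≤ M)
    (E : M →ₗ[ℂ] N) (hE : AmalgamatedLp.IsConditionalExpectation h E)
    (hσ : (AmalgamatedLp.invariantState h E).PosDef)
    (p : ℝ≥0∞) (hp : 1 ≤ p) :
    (∀ (n : ℕ) (v : Matrix (Fin n) (Fin n) M),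
      BddAbove (AmalgamatedLp.amalgamatedQuotients (AmalgamatedLp.matrixAlgebra n N)
        (AmalgamatedLp.ampState n (AmalgamatedLp.invariantState h E)) p
        (AmalgamatedLp.matrixIdent n M v : Matrix (Fin n × ι) (Fin n × ι) ℂ))) ∧
    AmalgamatedLp.IsOperatorSpaceStructure M
      (AmalgamatedLp.matrixNorm N M (AmalgamatedLp.invariantState h E) p) ∧
    (∀ y : M, AmalgamatedLp.matrixNorm N M (AmalgamatedLp.invariantState h E) p 1
        (Matrix.of fun _ _ => y) =
      AmalgamatedLp.amalgamatedNorm N M (AmalgamatedLp.invariantState h E) p y) := by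
  obtain ⟨c, hc⟩ := AmalgamatedLp.exists_isTracialWeight h hE hσ
  exact ⟨fun n v => hc.bddAbove_amp hp n _, hc.isOperatorSpaceStructure hp,
    fun y => hc.matrixNorm_one hp y⟩
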